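/- Let $k$ be a field and $\Lambda$ a finite dimensional $k$-algebra. Let $\operatorname{mod}\Lambda$ be the category of finitely generated right $\Lambda$-modules, $D=\operatorname{Hom}_k(-,k)$, and $\nu=D\operatorname{Hom}_\Lambda(-,\Lambda)$ the Nakayama functor. For a class $\mathcal S$ of objects of $\operatorname{mod}\Lambda$, $\operatorname{add}\mathcal S$ denotes the full subcategory of direct summands of finite direct sums of objects of $\mathcal S$. For $X\in\operatorname{mod}\Lambda$ with minimal projective resolution $\cdots\to P_2\xrightarrow{f}P_1\to P_0\to X\to 0$, put $$\tau_2X:=\operatorname{Ker}(\nu f:\nu P_2\to\nu P_1),$$ which is well defined up to isomorphism, and let $$\mathcal M:=\operatorname{add}\{\tau_2^i(D\Lambda)\mid i\ge 0\}\subset\operatorname{mod}\Lambda$$ be the $\tau_2$-closure of $D\Lambda$. A subcategory $\mathcal C$ of $\operatorname{mod}\Lambda$ is called $2$-rigid if $\operatorname{Ext}^1_\Lambda(X,Y)=0$ for all $X,Y\in\mathcal C$. An object $M\in\operatorname{mod}\Lambda$ is called $2$-cluster tilting if $\mathcal C=\operatorname{add}M$ is functorially finite in $\operatorname{mod}\Lambda$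 (that is, every $X\in\operatorname{mod}\Lambda$ admits a morphism $C\to X$ with $C\in\mathcal C$ through which every morphism from an object of $\mathcal C$ to $X$ factors, and dually a morphism $X\to C'$ with $C'\in\mathcal C$ through which every morphism from $X$ to an object of $\mathcal C$ factors) and $$\mathcal C=\{X\in\operatorname{mod}\Lambda\mid\operatorname{Ext}^1_\Lambda(X,\mathcal C)=0\}=\{X\in\operatorname{mod}\Lambda\mid\operatorname{Ext}^1_\Lambda(\mathcal C,X)=0\}.$$ Then: (a) $\mathcal M$ is $2$-rigid. (b) If $\operatorname{gl.dim}\Lambda\le 2$, then $\operatorname{mod}\Lambda$ has a $2$-cluster tilting object if and only if $\Lambda\in\mathcal M$. -/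

import Mathlib

open CategoryTheory

universe u

/-!
Throughout, `k` is a field and `Λ` a `k`-algebra.  Right `Λ`-modules are modules over `Λᵐᵒᵖ`, so
`mod Λ` consists of the objects `X` of `ModuleCat Λᵐᵒᵖ` with `Module.Finite Λᵐᵒᵖ X`.
A (full) subcategory is given by an `ObjectProperty`.
-/

namespace HigherAR

section Duality

/-- The `k`-linear dual `D N = Hom_k(N, k)`. -/
def KDual (k N : Type u) [Field k] [AddCommGroup N] [Module k N] : Type u := N →ₗ[k] k

variable {k : Type u} [Field k]

instance (N : Type u) [AddCommGroup N] [Module k N] : AddCommGroup (KDual k N) :=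
  inferInstanceAs (AddCommGroup (N →ₗ[k] k))

/-- The elements of `D N` as linear maps. -/
def KDual.toLinearMap {N : Type u} [AddCommGroup N] [Module k N] (f : KDual k N) : N →ₗ[k] k := f

/-- For a left `Λ`-module `N`, the dual `D N` is a right `Λ`-module by `(f · a)(x) = f (a x)`. -/
instance (Λ N : Type u) [Ring Λ] [Algebra k Λ] [AddCommGroup N] [Module k N] [Module Λ N]
    [IsScalarTower k Λ N] : Module Λᵐᵒᵖ (KDual k N) where
  smul a f := LinearMap.comp (KDual.toLinearMap f) (Algebra.lsmul k k N a.unop)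
  one_smul f := LinearMap.ext fun x => congrArg f.toLinearMap (one_smul Λ x)
  mul_smul a b f := LinearMap.ext fun x => congrArg f.toLinearMap (mul_smul b.unop a.unop x)
  smul_zero _ := LinearMap.ext fun _ => rfl
  smul_add _ _ _ := LinearMap.ext fun _ => rfl
  add_smul a b f := LinearMap.ext fun x =>
    (congrArg f.toLinearMap (add_smul a.unop b.unop x)).trans (map_add f.toLinearMap _ _)
  zero_smul f := LinearMap.ext fun x =>
    (congrArg f.toLinearMap (zero_smul Λ x)).trans (map_zero f.toLinearMap)

/-- The right `Λ`-linear map `D h : D N → D N'`, `φ ↦ φ ∘ h`, for a left `Λ`-linear map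
`h : N' → N`. -/
def KDual.map {Λ N N' : Type u} [Ring Λ] [Algebra k Λ]
    [AddCommGroup N] [Module k N] [Module Λ N] [IsScalarTower k Λ N]
    [AddCommGroup N'] [Module k N'] [Module Λ N'] [IsScalarTower k Λ N'] (h : N' →ₗ[Λ] N) :
    KDual k N →ₗ[Λᵐᵒᵖ] KDual k N' where
  toFun φ := φ.toLinearMap.comp (h.restrictScalars k)
  map_add' _ _ := rfl
  map_smul' a φ := LinearMap.ext fun x =>
    congrArg φ.toLinearMap (h.map_smul a.unop x).symm

variable (k) (Λ : Type u) [Ring Λ] [Algebra k Λ]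

/-- The right `Λ`-module `DΛ`. -/
abbrev dualAlgebra : ModuleCat.{u} Λᵐᵒᵖ := ModuleCat.of Λᵐᵒᵖ (KDual k Λ)

/-- The Nakayama functor `ν = D Hom_Λ(-, Λ)` on objects; here `Hom_Λ(P, Λ)` is a left `Λ`-module by
`(a g)(x) = a (g x)`. -/
abbrev nakayama (P : ModuleCat.{u} Λᵐᵒᵖ) : ModuleCat.{u} Λᵐᵒᵖ :=
  ModuleCat.of Λᵐᵒᵖ (KDual k (P →ₗ[Λᵐᵒᵖ] Λ))

variable {Λ}

/-- The left `Λ`-linear map `Hom_Λ(f, Λ) : Hom_Λ(Q, Λ) → Hom_Λ(P, Λ)`, `g ↦ g ∘ f`. -/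
def homToAlgebra {P Q : ModuleCat.{u} Λᵐᵒᵖ} (f : P ⟶ Q) :
    (Q →ₗ[Λᵐᵒᵖ] Λ) →ₗ[Λ] (P →ₗ[Λᵐᵒᵖ] Λ) where
  toFun g := g.comp f.hom
  map_add' _ _ := rfl
  map_smul' _ _ := rfl

/-- The Nakayama functor on morphisms, `ν f = D Hom_Λ(f, Λ)`. -/
def nakayamaMap {P Q : ModuleCat.{u} Λᵐᵒᵖ} (f : P ⟶ Q) : nakayama k Λ P ⟶ nakayama k Λ Q :=
  ModuleCat.ofHom (KDual.map (k := k) (homToAlgebra f))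

end Duality

section Syzygy

variable {R : Type u} [Ring R]

/-- `p : P ⟶ X` is a projective cover (in the category of finitely generated modules): `P` is
finitely generated projective, and `p` is surjective with superfluous kernel. -/
structure IsProjectiveCover {P X : ModuleCat.{u} R} (p : P ⟶ X) : Prop where
  finite : Module.Finite R P
  projective : Module.Projective R P
  surjective : Function.Surjective p
  superfluous : ∀ N : Submodule R P, N ⊔ LinearMap.ker p.hom = ⊤ → N = ⊤

/-- `Y` is a (minimal) syzygy `Ω X`: the kernel of a projective cover of `X`. -/
def IsSyzygy (X Y : ModuleCat.{u} R) : Prop :=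
  ∃ (P : ModuleCat.{u} R) (p : P ⟶ X), IsProjectiveCover p ∧
    Nonempty (Y ≅ ModuleCat.of R (LinearMap.ker p.hom))

/-- `Y` is an `m`-th (minimal) syzygy `Ω^m X`. -/
def IsIteratedSyzygy : ℕ → ModuleCat.{u} R → ModuleCat.{u} R → Prop
  | 0, X, Y => Nonempty (X ≅ Y)
  | m + 1, X, Y => ∃ Z, IsIteratedSyzygy m X Z ∧ IsSyzygy Z Y

end Syzygy

section Translation

variable (k : Type u) [Field k] {Λ : Type u} [Ring Λ] [Algebra k Λ]

/-- `Y` is the Auslander–Reiten translate `τ X = D Tr X`: the kernel of `ν f : ν P₁ → ν P₀`, where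
`P₁ --f--> P₀ → X → 0` is a minimal projective presentation of `X`, that is, `p : P₀ → X` and
`q : P₁ → ker p` are projective covers, and `f` is `q` followed by the inclusion. -/
def IsARTranslate (X Y : ModuleCat.{u} Λᵐᵒᵖ) : Prop :=
  ∃ (P₀ P₁ : ModuleCat.{u} Λᵐᵒᵖ) (p : P₀ ⟶ X)
    (q : P₁ ⟶ ModuleCat.of Λᵐᵒᵖ (LinearMap.ker p.hom)),
    IsProjectiveCover p ∧ IsProjectiveCover q ∧
      Nonempty (Y ≅ ModuleCat.of Λᵐᵒᵖ (LinearMap.ker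
        (nakayamaMap k (q ≫ ModuleCat.ofHom (LinearMap.ker p.hom).subtype)).hom))

/-- `Y` is the `n`-Auslander–Reiten translate `τ_n X = τ Ω^(n-1) X` (for `n ≥ 1`).  Explicitly, `Y`
is the kernel of `ν P_n → ν P_(n-1)` for a minimal projective resolution `P` of `X`; this determines
`Y` up to isomorphism. -/
def IsHigherARTranslate (n : ℕ) (X Y : ModuleCat.{u} Λᵐᵒᵖ) : Prop :=
  ∃ Z, IsIteratedSyzygy (n - 1) X Z ∧ IsARTranslate k Z Y

/-- `Y` is the iterated translate `τ_n^i X`. -/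
def IsIteratedTranslate (n : ℕ) : ℕ → ModuleCat.{u} Λᵐᵒᵖ → ModuleCat.{u} Λᵐᵒᵖ → Prop
  | 0, X, Y => Nonempty (X ≅ Y)
  | i + 1, X, Y => ∃ Z, IsIteratedTranslate n i X Z ∧ IsHigherARTranslate k n Z Y

end Translation

section Subcategories

variable {R : Type u} [Ring R]

/-- `add S`: the direct summands of finite direct sums of objects of `S`. -/
def addClosure (S : ObjectProperty (ModuleCat.{u} R)) : ObjectProperty (ModuleCat.{u} R) :=
  fun X => ∃ (m : ℕ) (Z : Fin m → ModuleCat.{u} R), (∀ j, S (Z j)) ∧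
    Nonempty (Retract X (ModuleCat.of R (∀ j, Z j)))

/-- `add M` for a single object `M`. -/
def addObject (M : ModuleCat.{u} R) : ObjectProperty (ModuleCat.{u} R) :=
  addClosure fun Z => Nonempty (Z ≅ M)

/-- `C` is contravariantly finite in the category of finitely generated modules. -/
def IsContravariantlyFinite (C : ObjectProperty (ModuleCat.{u} R)) : Prop :=
  ∀ X : ModuleCat.{u} R, Module.Finite R X → ∃ (Y : ModuleCat.{u} R) (f : Y ⟶ X), C Y ∧
    ∀ (Y' : ModuleCat.{u} R) (g : Y' ⟶ X), C Y' → ∃ h : Y' ⟶ Y, h ≫ f = g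

/-- `C` is covariantly finite in the category of finitely generated modules. -/
def IsCovariantlyFinite (C : ObjectProperty (ModuleCat.{u} R)) : Prop :=
  ∀ X : ModuleCat.{u} R, Module.Finite R X → ∃ (Y : ModuleCat.{u} R) (f : X ⟶ Y), C Y ∧
    ∀ (Y' : ModuleCat.{u} R) (g : X ⟶ Y'), C Y' → ∃ h : Y ⟶ Y', f ≫ h = g

/-- `C` is an `n`-rigid subcategory of the category of finitely generated modules:
`Ext^i(C, C) = 0` for `0 < i < n`. -/
structure IsRigid (n : ℕ) (C : ObjectProperty (ModuleCat.{u} R)) : Prop where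
  finite : ∀ X, C X → Module.Finite R X
  ext_eq_zero : ∀ X Y, C X → C Y → ∀ i, 0 < i → i < n → Subsingleton (Abelian.Ext X Y i)

/-- `C` is an `n`-cluster tilting subcategory of the category of finitely generated modules. -/
structure IsClusterTilting (n : ℕ) (C : ObjectProperty (ModuleCat.{u} R)) : Prop where
  contravariantlyFinite : IsContravariantlyFinite C
  covariantlyFinite : IsCovariantlyFinite C
  mem_iff_left : ∀ X, C X ↔ Module.Finite R X ∧
    ∀ Y, C Y → ∀ i, 0 < i → i < n → Subsingleton (Abelian.Ext X Y i)
  mem_iff_right : ∀ X, C X ↔ Module.Finite R X ∧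
    ∀ Y, C Y → ∀ i, 0 < i → i < n → Subsingleton (Abelian.Ext Y X i)

/-- `M` is an `n`-cluster tilting object of the category of finitely generated modules. -/
def IsClusterTiltingObject (n : ℕ) (M : ModuleCat.{u} R) : Prop :=
  Module.Finite R M ∧ IsClusterTilting n (addObject M)

variable (R) in
/-- `gl.dim R ≤ n`: every `R`-module has projective dimension at most `n`. -/
def GlobalDimensionLE (n : ℕ) : Prop :=
  ∀ X : ModuleCat.{u} R, HasProjectiveDimensionLE X n

end Subcategories

/-- The `τ_n`-closure `M_n(DΛ) = add {τ_n^i (DΛ) | i ≥ 0}` of `DΛ`. -/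
def tauClosure (k : Type u) [Field k] (Λ : Type u) [Ring Λ] [Algebra k Λ] (n : ℕ) :
    ObjectProperty (ModuleCat.{u} Λᵐᵒᵖ) :=
  addClosure fun Y => ∃ i : ℕ, IsIteratedTranslate k n i (dualAlgebra k Λ) Y

end HigherAR

/-! Everything rests on the duality D Hom(P, X) ≅ Hom(X, νP) for finitely generated projective P
(`ofDual`). It makes ν fully faithful on such P, with injective values. For a presentation P₂ → P₁ →
P₀ → Y → 0, vanishing of Ext¹(Y, X) means exactness of Hom(P₀, X) → Hom(P₁, X) → Hom(P₂, X), and the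
duality turns this into exactness of Hom(X, νP₂) → Hom(X, νP₁) → Hom(X, νP₀)
(`exists_extension_iff_exists_lifting_nakayama`). As τ₂Y = Ker(νP₂ → νP₁), Ext¹(Y, X) = 0 implies
Ext¹(X, τ₂Y) = 0, and conversely when Ext¹(Y, Λ) = 0. Using the implication twice reduces Ext¹(τ₂W,
τ₂Z) to Ext¹(W, Z); injectivity of DΛ ends the induction and gives (a).

Let gl.dim Λ ≤ 2. Resolutions then have length two and τ₂ = D Ext²(-, Λ) is an additive functor. A
module X with Ext¹(DΛ, X) = 0 splits as νH ⊕ τ₂Y, where Y = Coker(P₁ → P₀) is read off an injective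
resolution 0 → X → νP₂ → νP₁ → νP₀ → 0. Moreover Hom(Y, Λ) = 0, and Ext¹(W, X) = 0 implies Ext¹(Y,
W) = 0 (`exists_inverse_translate`).

If M is 2-cluster tilting, inverse translates stay in add M. Iterating from Λ gives a sequence with
no nonzero morphism from a later to an earlier term; since End(M) is finite dimensional, some term
is zero (`exists_id_eq_zero_of_hom_eq_zero`). Climbing back through X = νH ⊕ τ₂Y puts Λ into the
closure.

If Λ lies in the closure, (a) gives Ext¹(W, Λ) = 0 for W in the closure, so τ₂ is full there and
Hom(τ₂^i DΛ, τ₂^m DΛ) = 0 for i < m. A module receiving no nonzero morphism from the first n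
translates is zero for large n, because Λ is a summand of a sum of these. Hence the closure has an
additive generator, and repeated inverse translation shows that every X with Ext¹(closure, X) = 0
lies in it (`exists_decomposition`). Vanishing on the other side reduces to this one by the duality.
-/

namespace HigherAR

/-! ### Exact sequences of modules, kernels and factorizations -/

section Exactness

variable {R : Type u} [Ring R]

theorem exact_of_functionExact {A B C : ModuleCat.{u} R} {f : A ⟶ B} {g : B ⟶ C}
    (h : Function.Exact f g) :
    (ShortComplex.mk f g (by ext x; exact h.apply_apply_eq_zero x)).Exact :=
  (ShortComplex.ShortExact.moduleCat_exact_iff_function_exact _).2 h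

theorem comp_eq_zero_of_exact {A B C : ModuleCat.{u} R} {f : A ⟶ B} {g : B ⟶ C}
    (h : Function.Exact f g) : f ≫ g = 0 := by
  ext x; exact h.apply_apply_eq_zero x

theorem exists_lift_of_exact {A B C P : ModuleCat.{u} R} [Projective P] {f : A ⟶ B} {g : B ⟶ C}
    (h : Function.Exact f g) (φ : P ⟶ B) (hφ : φ ≫ g = 0) : ∃ ψ : P ⟶ A, ψ ≫ f = φ :=
  ⟨(exact_of_functionExact h).liftFromProjective φ hφ,
    (exact_of_functionExact h).liftFromProjective_comp φ hφ⟩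

theorem exists_desc_of_exact {A B C J : ModuleCat.{u} R} [Injective J] {f : A ⟶ B} {g : B ⟶ C}
    (h : Function.Exact f g) (φ : B ⟶ J) (hφ : f ≫ φ = 0) : ∃ ψ : C ⟶ J, g ≫ ψ = φ :=
  ⟨(exact_of_functionExact h).descToInjective φ hφ,
    (exact_of_functionExact h).comp_descToInjective φ hφ⟩

theorem shortExact_of_functionExact {A B C : ModuleCat.{u} R} {f : A ⟶ B} {g : B ⟶ C}
    (hf : Function.Injective f) (h : Function.Exact f g) (hg : Function.Surjective g) :
    (ShortComplex.mk f g (comp_eq_zero_of_exact h)).ShortExact :=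
  { exact := exact_of_functionExact h
    mono_f := (ModuleCat.mono_iff_injective f).2 hf
    epi_g := (ModuleCat.epi_iff_surjective g).2 hg }

/-- The inclusion of the kernel of a morphism. -/
abbrev kerι {A B : ModuleCat.{u} R} (f : A ⟶ B) :
    ModuleCat.of R (LinearMap.ker f.hom) ⟶ A :=
  ModuleCat.ofHom (LinearMap.ker f.hom).subtype

theorem kerι_injective {A B : ModuleCat.{u} R} (f : A ⟶ B) : Function.Injective (kerι f) :=
  Subtype.val_injective

theorem exact_kerι {A B : ModuleCat.{u} R} (f : A ⟶ B) : Function.Exact (kerι f) f := fun x =>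
  ⟨fun hx => ⟨⟨x, hx⟩, rfl⟩, by rintro ⟨y, rfl⟩; exact y.2⟩

theorem kerι_comp {A B : ModuleCat.{u} R} (f : A ⟶ B) : kerι f ≫ f = 0 :=
  comp_eq_zero_of_exact (exact_kerι f)

/-- The factorization through the kernel of a morphism. -/
abbrev kerLift {A B W : ModuleCat.{u} R} (f : A ⟶ B) (g : W ⟶ A) (h : g ≫ f = 0) :
    W ⟶ ModuleCat.of R (LinearMap.ker f.hom) :=
  ModuleCat.ofHom (LinearMap.codRestrict (LinearMap.ker f.hom) g.hom fun x =>
    congrArg (fun φ : W ⟶ B => φ x) h)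

theorem kerι_cancel {A B W : ModuleCat.{u} R} {f : A ⟶ B}
    {g h : W ⟶ ModuleCat.of R (LinearMap.ker f.hom)} (e : g ≫ kerι f = h ≫ kerι f) : g = h :=
  have := (ModuleCat.mono_iff_injective _).2 (kerι_injective f)
  (cancel_mono (kerι f)).1 e

theorem exists_kerLift {A B W : ModuleCat.{u} R} (f : A ⟶ B) (g : W ⟶ A) (h : g ≫ f = 0) :
    ∃ l : W ⟶ ModuleCat.of R (LinearMap.ker f.hom), l ≫ kerι f = g :=
  ⟨kerLift f g h, rfl⟩

/-- A morphism annihilating the left term of an exact sequence with surjective right map factors. -/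
theorem exists_desc_of_surjective {A B C W : ModuleCat.{u} R} {f : A ⟶ B} {g : B ⟶ C}
    (h : Function.Exact f g) (hg : Function.Surjective g) (φ : B ⟶ W) (hφ : f ≫ φ = 0) :
    ∃ ψ : C ⟶ W, g ≫ ψ = φ :=
  haveI : Epi (ShortComplex.mk f g (comp_eq_zero_of_exact h)).g :=
    (ModuleCat.epi_iff_surjective g).2 hg
  ⟨(exact_of_functionExact h).desc φ hφ, (exact_of_functionExact h).g_desc φ hφ⟩

/-- A morphism annihilated by the right map of a left exact sequence factors. -/
theorem exists_lift_of_injective {A B C W : ModuleCat.{u} R} {f : A ⟶ B} {g : B ⟶ C}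
    (h : Function.Exact f g) (hf : Function.Injective f) (φ : W ⟶ B) (hφ : φ ≫ g = 0) :
    ∃ ψ : W ⟶ A, ψ ≫ f = φ :=
  haveI : Mono (ShortComplex.mk f g (comp_eq_zero_of_exact h)).f :=
    (ModuleCat.mono_iff_injective f).2 hf
  ⟨(exact_of_functionExact h).lift φ hφ, (exact_of_functionExact h).lift_f φ hφ⟩

end Exactness

/-! ### Vanishing of Ext¹ as an extension or lifting property -/

section ExtOne

variable {R : Type u} [Ring R]

theorem exists_extension_of_ext_one {A B X Y : ModuleCat.{u} R} {f : A ⟶ B} {g : B ⟶ X}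
    (hf : Function.Injective f) (h : Function.Exact f g) (hg : Function.Surjective g)
    (hE : Subsingleton (Abelian.Ext X Y 1)) (φ : A ⟶ Y) : ∃ ψ : B ⟶ Y, f ≫ ψ = φ := by
  obtain ⟨x, hx⟩ := Abelian.Ext.contravariant_sequence_exact₁
    (shortExact_of_functionExact hf h hg) Y (Abelian.Ext.mk₀ φ) (add_zero 1)
    (Subsingleton.elim _ _)
  obtain ⟨ψ, rfl⟩ := Abelian.Ext.addEquiv₀.symm.surjective x
  refine ⟨ψ, Abelian.Ext.addEquiv₀.symm.injective ?_⟩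
  simpa using hx

theorem exists_lifting_of_ext_one {X Y B C : ModuleCat.{u} R} {f : Y ⟶ B} {g : B ⟶ C}
    (hf : Function.Injective f) (h : Function.Exact f g) (hg : Function.Surjective g)
    (hE : Subsingleton (Abelian.Ext X Y 1)) (φ : X ⟶ C) : ∃ ψ : X ⟶ B, ψ ≫ g = φ := by
  obtain ⟨x, hx⟩ := Abelian.Ext.covariant_sequence_exact₃ X
    (shortExact_of_functionExact hf h hg) (Abelian.Ext.mk₀ φ) (zero_add 1)
    (Subsingleton.elim _ _)
  obtain ⟨ψ, rfl⟩ := Abelian.Ext.addEquiv₀.symm.surjective x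
  refine ⟨ψ, Abelian.Ext.addEquiv₀.symm.injective ?_⟩
  simpa using hx

/-- Since Ext¹(P, Y) = 0, every class in Ext¹(X, Y) is the pushout of the given extension along some
A ⟶ Y, and a pushout along a morphism that extends to P splits. -/
theorem ext_one_of_exists_extension {A P X Y : ModuleCat.{u} R} [Projective P]
    {f : A ⟶ P} {g : P ⟶ X} (hf : Function.Injective f) (h : Function.Exact f g)
    (hg : Function.Surjective g) (H : ∀ φ : A ⟶ Y, ∃ ψ : P ⟶ Y, f ≫ ψ = φ) :
    Subsingleton (Abelian.Ext X Y 1) := by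
  refine subsingleton_of_forall_eq 0 fun e => ?_
  obtain ⟨x, rfl⟩ := Abelian.Ext.contravariant_sequence_exact₃
    (shortExact_of_functionExact hf h hg) Y e (Abelian.Ext.eq_zero_of_projective _) (add_zero 1)
  obtain ⟨φ, rfl⟩ := Abelian.Ext.addEquiv₀.symm.surjective x
  obtain ⟨ψ, rfl⟩ := H φ
  simp only [Abelian.Ext.addEquiv₀_symm_apply]
  rw [← Abelian.Ext.mk₀_comp_mk₀]
  exact (shortExact_of_functionExact hf h hg).extClass_comp_assoc _

theorem ext_one_of_exists_lifting {X Y I C : ModuleCat.{u} R} [Injective I]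
    {f : Y ⟶ I} {g : I ⟶ C} (hf : Function.Injective f) (h : Function.Exact f g)
    (hg : Function.Surjective g) (H : ∀ φ : X ⟶ C, ∃ ψ : X ⟶ I, ψ ≫ g = φ) :
    Subsingleton (Abelian.Ext X Y 1) := by
  refine subsingleton_of_forall_eq 0 fun e => ?_
  obtain ⟨x, rfl⟩ := Abelian.Ext.covariant_sequence_exact₁ X
    (shortExact_of_functionExact hf h hg) e (Abelian.Ext.eq_zero_of_injective _) (zero_add 1)
  obtain ⟨φ, rfl⟩ := Abelian.Ext.addEquiv₀.symm.surjective x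
  obtain ⟨ψ, rfl⟩ := H φ
  simp only [Abelian.Ext.addEquiv₀_symm_apply]
  rw [← Abelian.Ext.mk₀_comp_mk₀]
  simp only [Abelian.Ext.comp_assoc_of_second_deg_zero]
  rw [(shortExact_of_functionExact hf h hg).comp_extClass, Abelian.Ext.comp_zero]

/-- `Ext¹(X, Y)` vanishes if and only if `Hom(-, Y)` is exact at the middle of the deleted
presentation `P₂ → P₁ → P₀` of `X`. -/
theorem ext_one_iff_of_presentation {P₂ P₁ P₀ X Y : ModuleCat.{u} R} [Projective P₀]
    {d₂ : P₂ ⟶ P₁} {d₁ : P₁ ⟶ P₀} {p : P₀ ⟶ X} (h₁ : Function.Exact d₂ d₁)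
    (h₀ : Function.Exact d₁ p) (hp : Function.Surjective p) :
    Subsingleton (Abelian.Ext X Y 1) ↔
      ∀ φ : P₁ ⟶ Y, d₂ ≫ φ = 0 → ∃ ψ : P₀ ⟶ Y, d₁ ≫ ψ = φ := by
  obtain ⟨q, hq⟩ := exists_kerLift p d₁ (comp_eq_zero_of_exact h₀)
  have hqs : Function.Surjective q := by
    intro y
    obtain ⟨x, hx⟩ := (h₀ y.1).1 y.2
    exact ⟨x, Subtype.ext ((congrArg (fun f : P₁ ⟶ P₀ => f x) hq).trans hx)⟩
  have hqe : Function.Exact d₂ q := by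
    intro x
    rw [← h₁ x, ← hq]
    exact ⟨fun h => congrArg Subtype.val h, fun h => Subtype.ext h⟩
  constructor
  · intro hE φ hφ
    obtain ⟨χ, rfl⟩ := exists_desc_of_surjective hqe hqs φ hφ
    obtain ⟨ψ, rfl⟩ := exists_extension_of_ext_one (kerι_injective p) (exact_kerι p) hp hE χ
    exact ⟨ψ, by rw [← hq, Category.assoc]⟩
  · intro H
    refine ext_one_of_exists_extension (kerι_injective p) (exact_kerι p) hp fun φ => ?_
    obtain ⟨ψ, hψ⟩ := H (q ≫ φ) (by
      rw [← Category.assoc, comp_eq_zero_of_exact hqe, Limits.zero_comp])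
    have := (ModuleCat.epi_iff_surjective q).2 hqs
    exact ⟨ψ, (cancel_epi q).1 (by rw [← Category.assoc, hq, hψ])⟩

/-- The image factorization of a morphism. -/
theorem exists_image_factorization {A B : ModuleCat.{u} R} (f : A ⟶ B) :
    ∃ (C : ModuleCat.{u} R) (q : A ⟶ C) (i : C ⟶ B), Function.Surjective q ∧
      Function.Injective i ∧ q ≫ i = f :=
  ⟨ModuleCat.of R (LinearMap.range f.hom), ModuleCat.ofHom f.hom.rangeRestrict,
    ModuleCat.ofHom (LinearMap.range f.hom).subtype, LinearMap.surjective_rangeRestrict _,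
    Subtype.val_injective, rfl⟩

theorem exact_comp_injective_iff {A B C D : ModuleCat.{u} R} {f : A ⟶ B} {g : B ⟶ C} {i : C ⟶ D}
    (hi : Function.Injective i) : Function.Exact f (g ≫ i) ↔ Function.Exact f g := by
  refine forall_congr' fun x => ?_
  rw [show ((g ≫ i) x = 0 ↔ g x = 0) from ⟨fun h => hi (h.trans (map_zero i.hom).symm),
    fun h => (congrArg i h).trans (map_zero i.hom)⟩]

theorem exact_comp_surjective_iff {A B C D : ModuleCat.{u} R} {q : D ⟶ A} {f : A ⟶ B} {g : B ⟶ C}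
    (hq : Function.Surjective q) : Function.Exact (q ≫ f) g ↔ Function.Exact f g := by
  refine forall_congr' fun x => ?_
  rw [show (x ∈ Set.range (q ≫ f) ↔ x ∈ Set.range f) from
    ⟨fun ⟨y, hy⟩ => ⟨q y, hy⟩, fun ⟨y, hy⟩ => by
    obtain ⟨z, rfl⟩ := hq y
    exact ⟨z, hy⟩⟩]

/-- A morphism from X to the image of e₂ is killed by e₁ once composed into I₁, so it lifts. Only a
complex is needed at I₁, which is why rigidity of the closure requires no assumption on Ext¹(Y, Λ).
-/
theorem ext_one_of_copresentation {X Y I₂ I₁ I₀ : ModuleCat.{u} R} [Injective I₂]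
    {i : Y ⟶ I₂} {e₂ : I₂ ⟶ I₁} {e₁ : I₁ ⟶ I₀} (hi : Function.Injective i)
    (h₂ : Function.Exact i e₂) (h₁ : e₂ ≫ e₁ = 0)
    (H : ∀ φ : X ⟶ I₁, φ ≫ e₁ = 0 → ∃ ψ : X ⟶ I₂, ψ ≫ e₂ = φ) :
    Subsingleton (Abelian.Ext X Y 1) := by
  obtain ⟨C, q, j, hq, hj, rfl⟩ := exists_image_factorization e₂
  refine ext_one_of_exists_lifting hi ((exact_comp_injective_iff hj).1 h₂) hq fun φ => ?_
  have := (ModuleCat.epi_iff_surjective q).2 hq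
  have := (ModuleCat.mono_iff_injective j).2 hj
  have hj0 : j ≫ e₁ = 0 := (cancel_epi q).1 (by rw [← Category.assoc, h₁, Limits.comp_zero])
  obtain ⟨ψ, hψ⟩ := H (φ ≫ j) (by rw [Category.assoc, hj0, Limits.comp_zero])
  exact ⟨ψ, (cancel_mono j).1 (by rw [Category.assoc, hψ])⟩

/-- For this direction exactness at I₁ is essential: φ must factor through the image of e₂ before
the vanishing of Ext¹ can lift it. -/
theorem exists_lifting_of_copresentation {X Y I₂ I₁ I₀ : ModuleCat.{u} R}
    {i : Y ⟶ I₂} {e₂ : I₂ ⟶ I₁} {e₁ : I₁ ⟶ I₀} (hi : Function.Injective i)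
    (h₂ : Function.Exact i e₂) (h₁ : Function.Exact e₂ e₁)
    (hE : Subsingleton (Abelian.Ext X Y 1)) (φ : X ⟶ I₁) (hφ : φ ≫ e₁ = 0) :
    ∃ ψ : X ⟶ I₂, ψ ≫ e₂ = φ := by
  obtain ⟨C, q, j, hq, hj, rfl⟩ := exists_image_factorization e₂
  obtain ⟨χ, rfl⟩ := exists_lift_of_injective ((exact_comp_surjective_iff hq).1 h₁) hj φ hφ
  obtain ⟨ψ, rfl⟩ := exists_lifting_of_ext_one hi ((exact_comp_injective_iff hj).1 h₂) hq hE χ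
  exact ⟨ψ, by rw [Category.assoc]⟩

theorem exists_injective_embedding (Y : ModuleCat.{u} R) :
    ∃ (I C : ModuleCat.{u} R) (f : Y ⟶ I) (g : I ⟶ C), Injective I ∧ Function.Injective f ∧
      Function.Exact f g ∧ Function.Surjective g :=
  ⟨Injective.under Y, ModuleCat.of R (_ ⧸ LinearMap.range (Injective.ι Y).hom), Injective.ι Y,
    ModuleCat.ofHom (Submodule.mkQ _), inferInstance,
    (ModuleCat.mono_iff_injective _).1 inferInstance,
    LinearMap.exact_map_mkQ_range (Injective.ι Y).hom, Submodule.mkQ_surjective _⟩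

theorem exists_projective_cover_sequence (X : ModuleCat.{u} R) :
    ∃ (K P : ModuleCat.{u} R) (f : K ⟶ P) (g : P ⟶ X), Projective P ∧ Function.Injective f ∧
      Function.Exact f g ∧ Function.Surjective g :=
  ⟨_, Projective.over X, kerι (Projective.π X), Projective.π X, inferInstance,
    kerι_injective _, exact_kerι _, (ModuleCat.epi_iff_surjective _).1 inferInstance⟩

/-- If the identity of `X` is a sum of endomorphisms factoring through objects `Z j` with
`Ext¹(Z j, Y) = 0`, then `Ext¹(X, Y) = 0`. -/
theorem ext_one_of_sum_left {X Y : ModuleCat.{u} R} {ι : Type*} [Fintype ι]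
    {Z : ι → ModuleCat.{u} R} (a : ∀ j, X ⟶ Z j) (b : ∀ j, Z j ⟶ X) (hab : ∑ j, a j ≫ b j = 𝟙 X)
    (hZ : ∀ j, Subsingleton (Abelian.Ext (Z j) Y 1)) : Subsingleton (Abelian.Ext X Y 1) := by
  obtain ⟨I, C, f, g, _, hf, h, hg⟩ := exists_injective_embedding Y
  refine ext_one_of_exists_lifting hf h hg fun φ => ?_
  choose ψ hψ using fun j => exists_lifting_of_ext_one hf h hg (hZ j) (b j ≫ φ)
  refine ⟨∑ j, a j ≫ ψ j, ?_⟩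
  simp_rw [Preadditive.sum_comp, Category.assoc, hψ]
  conv_rhs => rw [← Category.id_comp φ, ← hab, Preadditive.sum_comp]
  simp

theorem ext_one_of_sum_right {X Y : ModuleCat.{u} R} {ι : Type*} [Fintype ι]
    {Z : ι → ModuleCat.{u} R} (a : ∀ j, Y ⟶ Z j) (b : ∀ j, Z j ⟶ Y) (hab : ∑ j, a j ≫ b j = 𝟙 Y)
    (hZ : ∀ j, Subsingleton (Abelian.Ext X (Z j) 1)) : Subsingleton (Abelian.Ext X Y 1) := by
  obtain ⟨K, P, f, g, _, hf, h, hg⟩ := exists_projective_cover_sequence X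
  refine ext_one_of_exists_extension hf h hg fun φ => ?_
  choose ψ hψ using fun j => exists_extension_of_ext_one hf h hg (hZ j) (φ ≫ a j)
  refine ⟨∑ j, ψ j ≫ b j, ?_⟩
  simp_rw [Preadditive.comp_sum, ← Category.assoc, hψ]
  conv_rhs => rw [← Category.comp_id φ, ← hab, Preadditive.comp_sum]
  simp

end ExtOne

/-! ### Additive closures through decompositions of the identity -/

section AddClosure

variable {R : Type u} [Ring R]

/-- Membership in `add S` in terms of a decomposition of the identity. -/
theorem addClosure_iff {S : ObjectProperty (ModuleCat.{u} R)} {X : ModuleCat.{u} R} :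
    addClosure S X ↔ ∃ (m : ℕ) (Z : Fin m → ModuleCat.{u} R) (a : ∀ j, X ⟶ Z j)
      (b : ∀ j, Z j ⟶ X), (∀ j, S (Z j)) ∧ ∑ j, a j ≫ b j = 𝟙 X := by
  constructor
  · rintro ⟨m, Z, hZ, ⟨r⟩⟩
    refine ⟨m, Z, fun j => r.i ≫ ModuleCat.ofHom (LinearMap.proj j),
      fun j => ModuleCat.ofHom (LinearMap.single R (fun j => Z j) j) ≫ r.r, hZ, ?_⟩
    rw [← r.retract]
    ext x
    simp only [ModuleCat.hom_sum, LinearMap.sum_apply]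
    simp only [ModuleCat.hom_comp, ModuleCat.hom_ofHom, LinearMap.comp_apply]
    rw [← map_sum]
    congr 1
    exact LinearMap.sum_single_apply _ _
  · rintro ⟨m, Z, a, b, hZ, hab⟩
    refine ⟨m, Z, hZ, ⟨⟨ModuleCat.ofHom (LinearMap.pi fun j => (a j).hom),
      ∑ j, ModuleCat.ofHom (LinearMap.proj j) ≫ b j, ?_⟩⟩⟩
    rw [Preadditive.comp_sum, ← hab]
    rfl

theorem addClosure_of_mem {S : ObjectProperty (ModuleCat.{u} R)} {X : ModuleCat.{u} R} (h : S X) :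
    addClosure S X :=
  addClosure_iff.2 ⟨1, fun _ => X, fun _ => 𝟙 X, fun _ => 𝟙 X, fun _ => h, by simp⟩

theorem addClosure_of_sum {S : ObjectProperty (ModuleCat.{u} R)} {X : ModuleCat.{u} R}
    {ι : Type*} [Fintype ι] {Z : ι → ModuleCat.{u} R} (a : ∀ j, X ⟶ Z j) (b : ∀ j, Z j ⟶ X)
    (hZ : ∀ j, addClosure S (Z j)) (hab : ∑ j, a j ≫ b j = 𝟙 X) : addClosure S X := by
  choose m W c d hW hcd using fun j => addClosure_iff.1 (hZ j)
  let e := (Fintype.equivFin ((j : ι) × Fin (m j)))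
  refine addClosure_iff.2 ⟨_, fun t => W (e.symm t).1 (e.symm t).2,
    fun t => a (e.symm t).1 ≫ c (e.symm t).1 (e.symm t).2,
    fun t => d (e.symm t).1 (e.symm t).2 ≫ b (e.symm t).1, fun t => hW _ _, ?_⟩
  rw [e.symm.sum_comp (fun s => (a s.1 ≫ c s.1 s.2) ≫ d s.1 s.2 ≫ b s.1), Fintype.sum_sigma,
    ← hab]
  refine Finset.sum_congr rfl fun j _ => ?_
  conv_rhs => rw [← Category.id_comp (b j), ← hcd j]
  simp [Preadditive.sum_comp, Preadditive.comp_sum]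

theorem addClosure_of_retract {S : ObjectProperty (ModuleCat.{u} R)} {X U : ModuleCat.{u} R}
    (a : X ⟶ U) (b : U ⟶ X) (hab : a ≫ b = 𝟙 X) (hU : addClosure S U) : addClosure S X :=
  addClosure_of_sum (ι := Unit) (fun _ => a) (fun _ => b) (fun _ => hU) (by simpa using hab)

theorem addClosure_of_add {S : ObjectProperty (ModuleCat.{u} R)} {X U V : ModuleCat.{u} R}
    (a : X ⟶ U) (b : U ⟶ X) (c : X ⟶ V) (d : V ⟶ X) (h : a ≫ b + c ≫ d = 𝟙 X)
    (hU : addClosure S U) (hV : addClosure S V) : addClosure S X :=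
  addClosure_of_sum (ι := Bool) (Z := fun t => cond t U V)
    (Bool.rec c a) (Bool.rec d b) (Bool.rec hV hU) (by simpa using h)

theorem ext_one_addClosure {S S' : ObjectProperty (ModuleCat.{u} R)}
    (h : ∀ X Y, S X → S' Y → Subsingleton (Abelian.Ext X Y 1)) {X Y : ModuleCat.{u} R}
    (hX : addClosure S X) (hY : addClosure S' Y) : Subsingleton (Abelian.Ext X Y 1) := by
  obtain ⟨m, Z, a, b, hZ, hab⟩ := addClosure_iff.1 hX
  obtain ⟨m', Z', a', b', hZ', hab'⟩ := addClosure_iff.1 hY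
  exact ext_one_of_sum_left a b hab fun j => ext_one_of_sum_right a' b' hab' fun j' =>
    h _ _ (hZ j) (hZ' j')

theorem finite_of_surjective {X Y : ModuleCat.{u} R} [Module.Finite R X] (f : X ⟶ Y)
    (hf : Function.Surjective f) : Module.Finite R Y :=
  Module.Finite.of_surjective f.hom hf

theorem finite_of_addClosure {S : ObjectProperty (ModuleCat.{u} R)}
    (h : ∀ X, S X → Module.Finite R X) {X : ModuleCat.{u} R} (hX : addClosure S X) :
    Module.Finite R X := by
  obtain ⟨m, Z, hZ, ⟨r⟩⟩ := hX
  have := fun j => h _ (hZ j)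
  refine finite_of_surjective r.r fun x => ⟨r.i x, ?_⟩
  exact congrArg (fun f : X ⟶ X => f x) r.retract

end AddClosure

end HigherAR

namespace HigherAR

open scoped ModuleCat

/-! ### The Nakayama functor and the duality D Hom(P, X) ≅ Hom(X, νP) -/

section Nakayama

variable {k : Type u} [Field k] {Λ : Type u} [Ring Λ] [Algebra k Λ]

theorem KDual.ext {N : Type u} [AddCommGroup N] [Module k N] {f g : KDual k N}
    (h : ∀ x, f.toLinearMap x = g.toLinearMap x) : f = g :=
  LinearMap.ext h

theorem nakayamaMap_apply {P Q : ModuleCat.{u} Λᵐᵒᵖ} (f : P ⟶ Q) (x : nakayama k Λ P)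
    (g : Q →ₗ[Λᵐᵒᵖ] Λ) :
    KDual.toLinearMap (nakayamaMap k f x) g = KDual.toLinearMap x (g.comp f.hom) := rfl

theorem nakayamaMap_id (P : ModuleCat.{u} Λᵐᵒᵖ) : nakayamaMap k (𝟙 P) = 𝟙 _ := rfl

theorem nakayamaMap_comp {P Q S : ModuleCat.{u} Λᵐᵒᵖ} (f : P ⟶ Q) (g : Q ⟶ S) :
    nakayamaMap k (f ≫ g) = nakayamaMap k f ≫ nakayamaMap k g := rfl

theorem nakayamaMap_add {P Q : ModuleCat.{u} Λᵐᵒᵖ} (f g : P ⟶ Q) :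
    nakayamaMap k (f + g) = nakayamaMap k f + nakayamaMap k g := by
  ext x
  refine KDual.ext fun h => ?_
  have : h.comp (f + g).hom = h.comp f.hom + h.comp g.hom :=
    LinearMap.ext fun p => map_add h _ _
  exact (congrArg (KDual.toLinearMap x) this).trans (map_add _ _ _)

theorem nakayamaMap_zero (P Q : ModuleCat.{u} Λᵐᵒᵖ) :
    nakayamaMap k (0 : P ⟶ Q) = 0 := by
  have := nakayamaMap_add (k := k) (0 : P ⟶ Q) 0
  simpa using this

theorem nakayamaMap_sub {P Q : ModuleCat.{u} Λᵐᵒᵖ} (f g : P ⟶ Q) :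
    nakayamaMap k (f - g) = nakayamaMap k f - nakayamaMap k g := by
  rw [eq_sub_iff_add_eq, ← nakayamaMap_add, sub_add_cancel]

theorem nakayamaMap_sum {P Q : ModuleCat.{u} Λᵐᵒᵖ} {ι : Type*} (s : Finset ι) (f : ι → (P ⟶ Q)) :
    nakayamaMap k (∑ i ∈ s, f i) = ∑ i ∈ s, nakayamaMap k (f i) :=
  map_sum (AddMonoidHom.mk' (nakayamaMap k (P := P) (Q := Q)) nakayamaMap_add) f s

/-- The homomorphism `p ↦ x · g(p)`. -/
def actHom {P X : ModuleCat.{u} Λᵐᵒᵖ} (x : X) (g : P →ₗ[Λᵐᵒᵖ] Λ) : P ⟶ X :=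
  ModuleCat.ofHom
    { toFun := fun p => MulOpposite.op (g p) • x
      map_add' := fun p q => by rw [map_add, MulOpposite.op_add, add_smul]
      map_smul' := fun a p => by
        rw [map_smul, RingHom.id_apply, smul_smul]
        rfl }

theorem actHom_comp {P X Y : ModuleCat.{u} Λᵐᵒᵖ} (x : X) (g : P →ₗ[Λᵐᵒᵖ] Λ) (f : X ⟶ Y) :
    actHom x g ≫ f = actHom (f x) g := by
  ext p
  exact map_smul f.hom _ _

theorem actHom_add_left {P X : ModuleCat.{u} Λᵐᵒᵖ} (x y : X) (g : P →ₗ[Λᵐᵒᵖ] Λ) :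
    actHom (x + y) g = actHom x g + actHom y g := by
  ext p
  exact smul_add _ _ _

theorem actHom_smul_left {P X : ModuleCat.{u} Λᵐᵒᵖ} (a : Λᵐᵒᵖ) (x : X) (g : P →ₗ[Λᵐᵒᵖ] Λ) :
    actHom (a • x) g = actHom x (a.unop • g) := by
  ext p
  exact smul_smul _ _ _

theorem actHom_add_right {P X : ModuleCat.{u} Λᵐᵒᵖ} (x : X) (g h : P →ₗ[Λᵐᵒᵖ] Λ) :
    actHom x (g + h) = actHom x g + actHom x h := by
  ext p
  exact add_smul _ _ _

theorem actHom_smul_right {P X : ModuleCat.{u} Λᵐᵒᵖ} (c : k) (x : X) (g : P →ₗ[Λᵐᵒᵖ] Λ) :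
    actHom x (c • g) = c • actHom x g := by
  ext p
  exact smul_assoc c (MulOpposite.op (g p)) x

/-- The natural map `D Hom(P, X) → Hom(X, ν P)`. -/
def ofDual {P X : ModuleCat.{u} Λᵐᵒᵖ} (θ : (P ⟶ X) →ₗ[k] k) : X ⟶ nakayama k Λ P :=
  ModuleCat.ofHom
    { toFun := fun x => show (P →ₗ[Λᵐᵒᵖ] Λ) →ₗ[k] k from
        { toFun := fun g => θ (actHom x g)
          map_add' := fun g h => by rw [actHom_add_right, map_add]
          map_smul' := fun c g => by rw [actHom_smul_right, map_smul, RingHom.id_apply] }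
      map_add' := fun x y => KDual.ext fun g =>
        (congrArg θ (actHom_add_left x y g)).trans (map_add θ _ _)
      map_smul' := fun a x => KDual.ext fun g => congrArg θ (actHom_smul_left a x g) }

theorem ofDual_apply {P X : ModuleCat.{u} Λᵐᵒᵖ} (θ : (P ⟶ X) →ₗ[k] k) (x : X)
    (g : P →ₗ[Λᵐᵒᵖ] Λ) : KDual.toLinearMap (ofDual θ x) g = θ (actHom x g) := rfl

theorem ofDual_comp_nakayamaMap {P Q X : ModuleCat.{u} Λᵐᵒᵖ} (d : P ⟶ Q)
    (θ : (P ⟶ X) →ₗ[k] k) :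
    ofDual θ ≫ nakayamaMap k d = ofDual (θ.comp (Linear.leftComp k X d)) := rfl

theorem comp_ofDual {P X Y : ModuleCat.{u} Λᵐᵒᵖ} (f : X ⟶ Y) (θ : (P ⟶ Y) →ₗ[k] k) :
    f ≫ ofDual θ = ofDual (θ.comp (Linear.rightComp k P f)) := by
  ext x
  refine KDual.ext fun g => ?_
  exact congrArg θ (actHom_comp x g f).symm

theorem exists_dualBasis (P : ModuleCat.{u} Λᵐᵒᵖ) [Module.Finite Λᵐᵒᵖ P]
    [Module.Projective Λᵐᵒᵖ P] : ∃ (n : ℕ) (e : Fin n → P) (g : Fin n → (P →ₗ[Λᵐᵒᵖ] Λ)),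
      ∀ p, ∑ i, MulOpposite.op (g i p) • e i = p := by
  obtain ⟨n, f, hf⟩ := Module.Finite.exists_fin' Λᵐᵒᵖ P
  obtain ⟨s, hs⟩ := Module.projective_lifting_property f LinearMap.id hf
  refine ⟨n, fun i => f (Pi.single i 1), fun i =>
    { toFun := fun p => (s p i).unop
      map_add' := fun p q => by simp
      map_smul' := fun a p => by simp }, fun p => ?_⟩
  have h1 : p = f (s p) := (LinearMap.congr_fun hs p).symm
  conv_rhs => rw [h1, ← LinearMap.sum_single_apply (fun _ => Λᵐᵒᵖ) (s p), map_sum]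
  refine Finset.sum_congr rfl fun i _ => ?_
  rw [← map_smul]
  congr 1
  ext j
  by_cases h : j = i
  · subst h; simp
  · simp [h]

theorem dualBasis_comp {P X : ModuleCat.{u} Λᵐᵒᵖ} {n : ℕ} {e : Fin n → P}
    {g : Fin n → (P →ₗ[Λᵐᵒᵖ] Λ)} (h : ∀ p, ∑ i, MulOpposite.op (g i p) • e i = p) (f : P ⟶ X) :
    ∑ i, actHom (f (e i)) (g i) = f := by
  ext p
  conv_rhs => rw [← h p, map_sum]
  rw [ModuleCat.hom_sum, LinearMap.sum_apply]
  exact Finset.sum_congr rfl fun i _ => (map_smul f.hom _ _).symm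

/-- By a dual basis, every morphism P ⟶ X is a sum of morphisms `actHom x g`, and `ofDual θ` records
exactly the values of θ on these. -/
theorem ofDual_injective {P X : ModuleCat.{u} Λᵐᵒᵖ} [Module.Finite Λᵐᵒᵖ P]
    [Module.Projective Λᵐᵒᵖ P] : Function.Injective (ofDual (k := k) (P := P) (X := X)) := by
  intro θ θ' hθ
  obtain ⟨n, e, g, h⟩ := exists_dualBasis P
  refine LinearMap.ext fun f => ?_
  rw [← dualBasis_comp h f, map_sum, map_sum]
  refine Finset.sum_congr rfl fun i _ => ?_
  rw [← ofDual_apply, ← ofDual_apply, hθ]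

theorem KDual.toLinearMap_add {N : Type u} [AddCommGroup N] [Module k N]
    (f g : KDual k N) (x : N) :
    (f + g).toLinearMap x = f.toLinearMap x + g.toLinearMap x := rfl

theorem nakayama_smul_apply {P : ModuleCat.{u} Λᵐᵒᵖ} (c : k) (x : nakayama k Λ P)
    (g : P →ₗ[Λᵐᵒᵖ] Λ) :
    KDual.toLinearMap (algebraMap k Λᵐᵒᵖ c • x) g = c * KDual.toLinearMap x g := by
  have : (algebraMap k Λᵐᵒᵖ c).unop • g = c • g := by
    ext p
    exact (Algebra.smul_def c (g p)).symm
  rw [← smul_eq_mul, ← map_smul, ← this]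
  rfl

theorem ofDual_surjective {P X : ModuleCat.{u} Λᵐᵒᵖ} [Module.Finite Λᵐᵒᵖ P]
    [Module.Projective Λᵐᵒᵖ P] : Function.Surjective (ofDual (k := k) (P := P) (X := X)) := by
  intro α
  obtain ⟨n, e, g, h⟩ := exists_dualBasis P
  -- The preimage is forced by expanding f = ∑ `actHom (f (e i)) (g i)` in a dual basis.
  refine ⟨{ toFun := fun f => ∑ i, KDual.toLinearMap (α (f (e i))) (g i)
            map_add' := fun f f' => ?_
            map_smul' := fun c f => ?_ }, ?_⟩
  · rw [← Finset.sum_add_distrib]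
    refine Finset.sum_congr rfl fun i _ => ?_
    rw [← KDual.toLinearMap_add, ← map_add]
    rfl
  · rw [RingHom.id_apply, Finset.smul_sum]
    refine Finset.sum_congr rfl fun i _ => ?_
    rw [smul_eq_mul, ← nakayama_smul_apply, ← map_smul, algebraMap_smul]
    rfl
  · ext x
    refine KDual.ext fun f => ?_
    change ∑ i, KDual.toLinearMap (α (MulOpposite.op (f (e i)) • x)) (g i) = _
    have : ∀ i, KDual.toLinearMap (α (MulOpposite.op (f (e i)) • x)) (g i) =
        KDual.toLinearMap (α x) (f (e i) • g i) := fun i => by rw [map_smul]; rfl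
    simp_rw [this]
    rw [← map_sum]
    congr 1
    ext p
    conv_rhs => rw [← h p, map_sum]
    rw [LinearMap.sum_apply]
    refine Finset.sum_congr rfl fun i _ => ?_
    rw [map_smul]
    rfl

theorem exists_comp_eq_of_ker_le {V W : Type*} [AddCommGroup V] [Module k V] [AddCommGroup W]
    [Module k W] (f : V →ₗ[k] W) (θ : V →ₗ[k] k) (h : ∀ v, f v = 0 → θ v = 0) :
    ∃ θ' : W →ₗ[k] k, θ'.comp f = θ := by
  have : θ ∈ LinearMap.range f.dualMap := by
    rw [LinearMap.range_dualMap_eq_dualAnnihilator_ker]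
    exact (Submodule.mem_dualAnnihilator _).2 h
  exact this

/-- Hom(-, νP) is D Hom(P, -): the functor Hom(P, -) preserves monomorphisms, and D turns them into
surjections. -/
theorem nakayama_injective (P : ModuleCat.{u} Λᵐᵒᵖ) [Module.Finite Λᵐᵒᵖ P]
    [Module.Projective Λᵐᵒᵖ P] : Injective (nakayama k Λ P) where
  factors {X Y} g f hf := by
    obtain ⟨θ, rfl⟩ := ofDual_surjective g
    obtain ⟨θ', hθ'⟩ := exists_comp_eq_of_ker_le (Linear.rightComp k P f) θ fun v hv => by
      rw [(cancel_mono f).1 ((show v ≫ f = 0 from hv).trans Limits.zero_comp.symm), map_zero]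
    exact ⟨ofDual θ', by rw [comp_ofDual, hθ']⟩

/-- The exactness of `Hom(P₀, X) → Hom(P₁, X) → Hom(P₂, X)` is equivalent to that of
`Hom(X, ν P₂) → Hom(X, ν P₁) → Hom(X, ν P₀)`. -/
theorem exists_extension_iff_exists_lifting_nakayama (k : Type u) [Field k] [Algebra k Λ]
    {P₂ P₁ P₀ : ModuleCat.{u} Λᵐᵒᵖ}
    [Module.Finite Λᵐᵒᵖ P₂] [Module.Projective Λᵐᵒᵖ P₂] [Module.Finite Λᵐᵒᵖ P₁]
    [Module.Projective Λᵐᵒᵖ P₁] [Module.Finite Λᵐᵒᵖ P₀] [Module.Projective Λᵐᵒᵖ P₀]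
    (d₂ : P₂ ⟶ P₁) (d₁ : P₁ ⟶ P₀) (X : ModuleCat.{u} Λᵐᵒᵖ) :
    (∀ φ : P₁ ⟶ X, d₂ ≫ φ = 0 → ∃ ψ : P₀ ⟶ X, d₁ ≫ ψ = φ) ↔
      ∀ φ : X ⟶ nakayama k Λ P₁, φ ≫ nakayamaMap k d₁ = 0 →
        ∃ ψ : X ⟶ nakayama k Λ P₂, ψ ≫ nakayamaMap k d₂ = φ := by
  constructor
  · intro H φ hφ
    obtain ⟨θ, rfl⟩ := ofDual_surjective φ
    rw [ofDual_comp_nakayamaMap] at hφ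
    have h0 : θ.comp (Linear.leftComp k X d₁) = 0 := ofDual_injective (hφ.trans rfl)
    obtain ⟨θ', hθ'⟩ := exists_comp_eq_of_ker_le (Linear.leftComp k X d₂) θ fun v hv => by
      obtain ⟨ψ, rfl⟩ := H v hv
      exact LinearMap.congr_fun h0 ψ
    exact ⟨ofDual θ', by rw [ofDual_comp_nakayamaMap, hθ']⟩
  · intro H φ hφ
    -- If φ is not in the image of Hom(P₀, X), a functional θ vanishing on that image but not at φ
    -- corresponds to a morphism X ⟶ νP₁ killed by ν d₁. Lifting it to νP₂ writes θ as θ' composed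
    -- with precomposition by d₂, so θ φ = 0.
    by_contra hc
    have hmem : φ ∉ LinearMap.range (Linear.leftComp k X d₁) := fun ⟨ψ, hψ⟩ => hc ⟨ψ, hψ⟩
    obtain ⟨θ, hθ, hle⟩ := Submodule.exists_le_ker_of_notMem hmem
    obtain ⟨ψ, hψ⟩ := H (ofDual θ) (by
      rw [ofDual_comp_nakayamaMap, show θ.comp (Linear.leftComp k X d₁) = 0 from
        LinearMap.ext fun v => hle ⟨v, rfl⟩]
      rfl)
    obtain ⟨θ', rfl⟩ := ofDual_surjective ψ
    rw [ofDual_comp_nakayamaMap] at hψ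
    apply hθ
    rw [← ofDual_injective hψ]
    exact (congrArg θ' hφ).trans (map_zero θ')

theorem KDual.eq_of_forall {N : Type u} [AddCommGroup N] [Module k N] {x y : N}
    (h : ∀ f : KDual k N, f.toLinearMap x = f.toLinearMap y) : x = y := by
  rw [← sub_eq_zero, ← Module.forall_dual_apply_eq_zero_iff k]
  intro f
  rw [map_sub, sub_eq_zero]
  exact h f

/-- Functionals separate the elements of Hom(P, Λ), and the coordinate functions of a dual basis
separate the points of Q. -/
theorem nakayamaMap_injective {P Q : ModuleCat.{u} Λᵐᵒᵖ} [Module.Finite Λᵐᵒᵖ Q]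
    [Module.Projective Λᵐᵒᵖ Q] {f g : P ⟶ Q} (h : nakayamaMap k f = nakayamaMap k g) : f = g := by
  obtain ⟨n, e, c, hc⟩ := exists_dualBasis Q
  have key : ∀ c : Q →ₗ[Λᵐᵒᵖ] Λ, c.comp f.hom = c.comp g.hom := fun c =>
    KDual.eq_of_forall (k := k) fun x =>
      (nakayamaMap_apply f x c).symm.trans (by rw [h]; rfl)
  ext p
  rw [← hc (f.hom p), ← hc (g.hom p)]
  refine Finset.sum_congr rfl fun i _ => ?_
  rw [show c i (f.hom p) = c i (g.hom p) from LinearMap.congr_fun (key (c i)) p]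

end Nakayama

/-! ### Finite dimensionality and fullness of ν -/

section FiniteDimensional

variable {k : Type u} [Field k] {Λ : Type u} [Ring Λ] [Algebra k Λ]

theorem finiteDimensional_linearMap (P N : Type u) [AddCommGroup P] [Module k P] [Module Λᵐᵒᵖ P]
    [IsScalarTower k Λᵐᵒᵖ P] [AddCommGroup N] [Module k N] [Module Λᵐᵒᵖ N]
    [SMulCommClass Λᵐᵒᵖ k N] [LinearMap.CompatibleSMul P N k Λᵐᵒᵖ]
    [FiniteDimensional k P] [FiniteDimensional k N] :
    FiniteDimensional k (P →ₗ[Λᵐᵒᵖ] N) :=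
  Module.Finite.of_injective (LinearMap.restrictScalarsₗ k Λᵐᵒᵖ P N k)
    (LinearMap.restrictScalars_injective k)

theorem isScalarTower_mulOpposite_self : IsScalarTower k Λᵐᵒᵖ Λ where
  smul_assoc c a x := by
    rw [MulOpposite.smul_eq_mul_unop, MulOpposite.smul_eq_mul_unop, MulOpposite.unop_smul,
      mul_smul_comm]

theorem finite_kDual (N : Type u) [AddCommGroup N] [Module k N] [Module Λ N] [IsScalarTower k Λ N]
    [FiniteDimensional k N] : Module.Finite Λᵐᵒᵖ (KDual k N) := by
  let _ : Module k (KDual k N) := Module.restrictScalars k Λᵐᵒᵖ (KDual k N)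
  have : IsScalarTower k Λᵐᵒᵖ (KDual k N) := IsScalarTower.restrictScalars k Λᵐᵒᵖ (KDual k N)
  let e : (N →ₗ[k] k) ≃ₗ[k] KDual k N :=
    { toFun := fun f => f
      invFun := fun f => f
      map_add' := fun _ _ => rfl
      map_smul' := fun c f => LinearMap.ext fun x => by
        refine (f.map_smul c x).symm.trans (congrArg f ?_)
        exact (algebraMap_smul Λ c x).symm
      left_inv := fun _ => rfl
      right_inv := fun _ => rfl }
  have : Module.Finite k (KDual k N) := Module.Finite.equiv e
  exact Module.Finite.of_restrictScalars_finite k Λᵐᵒᵖ (KDual k N)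

variable [FiniteDimensional k Λ]

instance : Module.Finite k Λᵐᵒᵖ :=
  Module.Finite.equiv (MulOpposite.opLinearEquiv k : Λ ≃ₗ[k] Λᵐᵒᵖ)

theorem finiteDimensional_of_finite (k : Type u) [Field k] [Algebra k Λ] [FiniteDimensional k Λ]
    (X : ModuleCat.{u} Λᵐᵒᵖ) [Module.Finite Λᵐᵒᵖ X] : FiniteDimensional k X :=
  Module.Finite.trans Λᵐᵒᵖ X

theorem isNoetherianRing_mulOpposite (k Λ : Type u) [Field k] [Ring Λ] [Algebra k Λ]
    [FiniteDimensional k Λ] : IsNoetherianRing Λᵐᵒᵖ :=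
  isNoetherian_of_tower k (inferInstance : IsNoetherian k Λᵐᵒᵖ)

theorem isArtinianRing_mulOpposite (k Λ : Type u) [Field k] [Ring Λ] [Algebra k Λ]
    [FiniteDimensional k Λ] : IsArtinianRing Λᵐᵒᵖ :=
  isArtinian_of_tower k (inferInstance : IsArtinian k Λᵐᵒᵖ)

theorem finite_nakayama (P : ModuleCat.{u} Λᵐᵒᵖ) [Module.Finite Λᵐᵒᵖ P] :
    Module.Finite Λᵐᵒᵖ (nakayama k Λ P) := by
  have := finiteDimensional_of_finite k P
  have := isScalarTower_mulOpposite_self (k := k) (Λ := Λ)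
  have : FiniteDimensional k (P →ₗ[Λᵐᵒᵖ] Λ) := finiteDimensional_linearMap P Λ
  exact finite_kDual _

theorem finite_dualAlgebra : Module.Finite Λᵐᵒᵖ (dualAlgebra k Λ) := finite_kDual Λ

theorem finiteDimensional_hom (P Q : ModuleCat.{u} Λᵐᵒᵖ) [Module.Finite Λᵐᵒᵖ P]
    [Module.Finite Λᵐᵒᵖ Q] : FiniteDimensional k (P ⟶ Q) := by
  have := finiteDimensional_of_finite k P
  have := finiteDimensional_of_finite k Q
  have : FiniteDimensional k (P →ₗ[Λᵐᵒᵖ] Q) := finiteDimensional_linearMap P Q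
  exact Module.Finite.equiv (ModuleCat.homLinearEquiv (S := k) (M := P) (N := Q)).symm

/-- Two applications of the duality give Hom(νP, νQ) ≅ D Hom(Q, νP) ≅ DD Hom(P, Q), and Hom(P, Q) is
reflexive because it is finite dimensional. -/
theorem exists_nakayamaMap_eq {P Q : ModuleCat.{u} Λᵐᵒᵖ} [Module.Finite Λᵐᵒᵖ P]
    [Module.Projective Λᵐᵒᵖ P] [Module.Finite Λᵐᵒᵖ Q] [Module.Projective Λᵐᵒᵖ Q]
    (φ : nakayama k Λ P ⟶ nakayama k Λ Q) : ∃ f : P ⟶ Q, nakayamaMap k f = φ := by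
  obtain ⟨θ, rfl⟩ := ofDual_surjective φ
  have : FiniteDimensional k (P ⟶ Q) := finiteDimensional_hom P Q
  let ξ : Module.Dual k (Module.Dual k (P ⟶ Q)) :=
    { toFun := fun η => θ (ofDual η)
      map_add' := fun η η' => by rw [← map_add]; rfl
      map_smul' := fun c η => by
        rw [RingHom.id_apply, ← map_smul]
        congr 1
        ext x
        exact KDual.ext fun g => (nakayama_smul_apply c (ofDual η x) g).symm }
  obtain ⟨f, hf⟩ := (Module.evalEquiv k (P ⟶ Q)).surjective ξ
  refine ⟨f, ?_⟩
  ext x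
  refine KDual.ext fun g => ?_
  -- The functional f' ↦ x(g ∘ f') is chosen so that `ofDual η` is `actHom x g`, at which θ computes
  -- the value of φ.
  let η : Module.Dual k (P ⟶ Q) :=
    { toFun := fun f' => KDual.toLinearMap x (g.comp f'.hom)
      map_add' := fun f' f'' => by
        rw [← map_add]
        congr 1
        ext p
        exact map_add g _ _
      map_smul' := fun c f' => by
        rw [RingHom.id_apply, ← map_smul]
        congr 1
        have := isScalarTower_mulOpposite_self (k := k) (Λ := Λ)
        ext p
        change g (c • f' p) = c • g (f' p)
        rw [← algebraMap_smul Λᵐᵒᵖ c (f' p), map_smul, algebraMap_smul] }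
  have h1 : ofDual η = actHom x g := by
    ext q
    refine KDual.ext fun h => ?_
    change KDual.toLinearMap x _ = KDual.toLinearMap x _
    congr 1
    ext p
    exact map_smul g _ _
  change η f = θ (actHom x g)
  rw [← h1]
  exact LinearMap.congr_fun hf η

/-- The right regular module as an object. -/
abbrev regular (Λ : Type u) [Ring Λ] : ModuleCat.{u} Λᵐᵒᵖ := ModuleCat.of Λᵐᵒᵖ Λ

/-- The regular right module is free of rank one over the opposite algebra. -/
def regularEquiv (Λ : Type u) [Ring Λ] : Λᵐᵒᵖ ≃ₗ[Λᵐᵒᵖ] Λ where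
  toFun := MulOpposite.unop
  invFun := MulOpposite.op
  map_add' _ _ := rfl
  map_smul' _ _ := rfl
  left_inv _ := rfl
  right_inv _ := rfl

instance (Λ : Type u) [Ring Λ] : Module.Finite Λᵐᵒᵖ Λ := Module.Finite.equiv (regularEquiv Λ)

instance (Λ : Type u) [Ring Λ] : Module.Projective Λᵐᵒᵖ Λ :=
  Module.Projective.of_equiv (regularEquiv Λ)

end FiniteDimensional

/-! ### DΛ = νΛ, embeddings into νP, and injectives as νP -/

section DualAlgebra

variable {k : Type u} [Field k] {Λ : Type u} [Ring Λ] [Algebra k Λ]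

/-- The endomorphisms of the regular module, as a left module. -/
def endRegularEquiv (Λ : Type u) [Ring Λ] : (Λ →ₗ[Λᵐᵒᵖ] Λ) ≃ₗ[Λ] Λ where
  toFun g := g 1
  invFun a := LinearMap.mulLeft Λᵐᵒᵖ a
  map_add' _ _ := rfl
  map_smul' _ _ := rfl
  left_inv g := by
    ext
    simp
  right_inv a := mul_one a

/-- `DΛ` is the Nakayama functor applied to `Λ`. -/
def dualAlgebraIso : dualAlgebra k Λ ≅ nakayama k Λ (regular Λ) :=
  { hom := ModuleCat.ofHom (KDual.map (k := k) (endRegularEquiv Λ).toLinearMap)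
    inv := ModuleCat.ofHom (KDual.map (k := k) (endRegularEquiv Λ).symm.toLinearMap)
    hom_inv_id := by
      ext x
      exact KDual.ext fun a => congrArg (KDual.toLinearMap x)
        ((endRegularEquiv Λ).apply_symm_apply a)
    inv_hom_id := by
      ext x
      exact KDual.ext fun a => congrArg (KDual.toLinearMap x)
        ((endRegularEquiv Λ).symm_apply_apply a) }

/-- The homomorphism from the regular module sending `1` to `x`. -/
def fromRegular {X : ModuleCat.{u} Λᵐᵒᵖ} (x : X) : regular Λ ⟶ X := actHom x LinearMap.id

theorem fromRegular_apply_one {X : ModuleCat.{u} Λᵐᵒᵖ} (x : X) :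
    fromRegular x (1 : Λ) = x := one_smul _ x

theorem sum_comp_fromRegular {P : ModuleCat.{u} Λᵐᵒᵖ} {n : ℕ} {e : Fin n → P}
    {g : Fin n → (P →ₗ[Λᵐᵒᵖ] Λ)} (h : ∀ p, ∑ i, MulOpposite.op (g i p) • e i = p) :
    ∑ i, (ModuleCat.ofHom (g i) : P ⟶ regular Λ) ≫ fromRegular (e i) = 𝟙 P :=
  dualBasis_comp h (𝟙 P)

theorem addClosure_nakayama {S : ObjectProperty (ModuleCat.{u} Λᵐᵒᵖ)}
    (hS : addClosure S (dualAlgebra k Λ)) (P : ModuleCat.{u} Λᵐᵒᵖ) [Module.Finite Λᵐᵒᵖ P]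
    [Module.Projective Λᵐᵒᵖ P] : addClosure S (nakayama k Λ P) := by
  obtain ⟨n, e, g, h⟩ := exists_dualBasis P
  refine addClosure_of_sum (Z := fun _ : Fin n => dualAlgebra k Λ)
    (fun i => nakayamaMap k (ModuleCat.ofHom (g i) : P ⟶ regular Λ) ≫ dualAlgebraIso.inv)
    (fun i => dualAlgebraIso.hom ≫ nakayamaMap k (fromRegular (e i))) (fun _ => hS) ?_
  rw [← nakayamaMap_id, ← sum_comp_fromRegular h, nakayamaMap_sum]
  simp [nakayamaMap_comp]

theorem dualAlgebra_injective : Injective (dualAlgebra k Λ) :=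
  have := nakayama_injective (k := k) (regular Λ)
  Injective.of_iso dualAlgebraIso.symm inferInstance

variable [FiniteDimensional k Λ]

/-- Every finitely generated module embeds into `ν P` for some finitely generated projective. -/
theorem exists_embedding_nakayama (k : Type u) [Field k] [Algebra k Λ] [FiniteDimensional k Λ]
    (X : ModuleCat.{u} Λᵐᵒᵖ) [Module.Finite Λᵐᵒᵖ X] :
    ∃ (P : ModuleCat.{u} Λᵐᵒᵖ) (i : X ⟶ nakayama k Λ P), Module.Finite Λᵐᵒᵖ P ∧
      Module.Projective Λᵐᵒᵖ P ∧ Function.Injective i := by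
  have := finiteDimensional_of_finite k X
  let b := Module.finBasis k X
  let n := Module.finrank k X
  let P : ModuleCat.{u} Λᵐᵒᵖ := ModuleCat.of Λᵐᵒᵖ (Fin n → Λ)
  -- With P = Λⁿ and n = dim X, θ applies the i-th coordinate of X to the image of the i-th basis
  -- vector. Then `ofDual θ x` evaluated at the i-th projection is the i-th coordinate of x, whence
  -- injectivity.
  let θ : (P ⟶ X) →ₗ[k] k :=
    { toFun := fun f => ∑ i, b.coord i (f (Pi.single i (1 : Λ) : Fin n → Λ))
      map_add' := fun f g => by
        rw [← Finset.sum_add_distrib]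
        exact Finset.sum_congr rfl fun i _ => map_add (b.coord i) _ _
      map_smul' := fun c f => by
        rw [Finset.smul_sum]
        exact Finset.sum_congr rfl fun i _ => map_smul (b.coord i) c _ }
  refine ⟨P, ofDual θ, inferInstanceAs (Module.Finite Λᵐᵒᵖ (Fin n → Λ)),
    Module.Projective.of_equiv (LinearEquiv.piCongrRight fun _ : Fin n => regularEquiv Λ), ?_⟩
  refine (injective_iff_map_eq_zero (ofDual θ).hom).2 fun x hx => ?_
  refine b.forall_coord_eq_zero_iff.1 fun i => ?_
  have h : θ (actHom x (LinearMap.proj i)) = 0 :=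
    congrArg (fun y => KDual.toLinearMap y (LinearMap.proj i)) hx
  rw [← h]
  change b.coord i x = ∑ j, b.coord j (MulOpposite.op ((Pi.single j (1 : Λ) : Fin n → Λ) i) • x)
  rw [Finset.sum_eq_single i]
  · simp
  · intro j _ hj
    simp [hj.symm]
  · simp

/-- Every finitely generated injective module is of the form `ν P`. -/
theorem exists_iso_nakayama_of_injective (k : Type u) [Field k] [Algebra k Λ]
    [FiniteDimensional k Λ] (X : ModuleCat.{u} Λᵐᵒᵖ) [Module.Finite Λᵐᵒᵖ X] [Injective X] :
    ∃ P : ModuleCat.{u} Λᵐᵒᵖ, Module.Finite Λᵐᵒᵖ P ∧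
      Module.Projective Λᵐᵒᵖ P ∧ Nonempty (X ≅ nakayama k Λ P) := by
  obtain ⟨F, i, _, _, hi⟩ := exists_embedding_nakayama k X
  have := (ModuleCat.mono_iff_injective i).2 hi
  let r := Injective.factorThru (𝟙 X) i
  have hr : i ≫ r = 𝟙 X := Injective.comp_factorThru (𝟙 X) i
  -- The projector of νF onto X comes from an idempotent e of F; its image P is a summand of F, and
  -- νP is the image of the projector.
  obtain ⟨e, he⟩ := exists_nakayamaMap_eq (r ≫ i)
  have hee : e ≫ e = e := nakayamaMap_injective (k := k) (by
    rw [nakayamaMap_comp, he, Category.assoc, reassoc_of% hr])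
  obtain ⟨P, q, j, hq, hj, hqj⟩ := exists_image_factorization e
  have := (ModuleCat.epi_iff_surjective q).2 hq
  have := (ModuleCat.mono_iff_injective j).2 hj
  have hjq : j ≫ q = 𝟙 P := (cancel_epi q).1 ((cancel_mono j).1 (by
    simp only [Category.assoc, hqj, Category.comp_id]
    rw [← Category.assoc, hqj, hee]))
  refine ⟨P, Module.Finite.of_surjective q.hom hq,
    Module.Projective.of_split j.hom q.hom (by rw [← ModuleCat.hom_comp, hjq]; rfl), ⟨?_⟩⟩
  exact
    { hom := i ≫ nakayamaMap k q
      inv := nakayamaMap k j ≫ r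
      hom_inv_id := by
        rw [Category.assoc, ← Category.assoc (nakayamaMap k q), ← nakayamaMap_comp, hqj, he,
          Category.assoc, hr, Category.comp_id, hr]
      inv_hom_id := by
        rw [Category.assoc, ← Category.assoc r, ← he, ← nakayamaMap_comp, ← nakayamaMap_comp,
          ← hqj, Category.assoc, hjq, Category.comp_id, hjq, nakayamaMap_id] }

end DualAlgebra

end HigherAR

namespace HigherAR

open scoped ModuleCat

/-! ### Presentations, the translate, and rigidity of the closure -/

section Presentation

/-- An exact sequence `P₂ → P₁ → P₀ → Y → 0` with finitely generated projective terms `Pᵢ`. -/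
structure Presentation {R : Type u} [Ring R] (Y : ModuleCat.{u} R) where
  /-- the term in degree two -/
  P₂ : ModuleCat.{u} R
  /-- the term in degree one -/
  P₁ : ModuleCat.{u} R
  /-- the term in degree zero -/
  P₀ : ModuleCat.{u} R
  /-- the differential out of degree two -/
  d₂ : P₂ ⟶ P₁
  /-- the differential out of degree one -/
  d₁ : P₁ ⟶ P₀
  /-- the augmentation -/
  p : P₀ ⟶ Y
  finite₂ : Module.Finite R P₂
  finite₁ : Module.Finite R P₁
  finite₀ : Module.Finite R P₀
  projective₂ : Module.Projective R P₂
  projective₁ : Module.Projective R P₁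
  projective₀ : Module.Projective R P₀
  exact₁ : Function.Exact d₂ d₁
  exact₀ : Function.Exact d₁ p
  surjective : Function.Surjective p

attribute [instance] Presentation.finite₂ Presentation.finite₁ Presentation.finite₀
  Presentation.projective₂ Presentation.projective₁ Presentation.projective₀

instance {R : Type u} [Ring R] (P : ModuleCat.{u} R) [Module.Projective R P] : Projective P :=
  P.projective_of_categoryTheory_projective

variable {k : Type u} [Field k] {Λ : Type u} [Ring Λ] [Algebra k Λ]

variable (k) in
/-- The kernel of `ν P₂ → ν P₁`. -/
abbrev Presentation.tau {Y : ModuleCat.{u} Λᵐᵒᵖ} (R : Presentation Y) : ModuleCat.{u} Λᵐᵒᵖ :=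
  ModuleCat.of Λᵐᵒᵖ (LinearMap.ker (nakayamaMap k R.d₂).hom)

variable {X Y : ModuleCat.{u} Λᵐᵒᵖ}

theorem Presentation.nakayamaMap_comp_eq_zero (R : Presentation Y) :
    nakayamaMap k R.d₂ ≫ nakayamaMap k R.d₁ = 0 := by
  rw [← nakayamaMap_comp, comp_eq_zero_of_exact R.exact₁, nakayamaMap_zero]

/-- The Nakayama duality carries the extension property defining Ext¹(Y, X) = 0 to a lifting
property along ν d₂, whose kernel is the translate. -/
theorem Presentation.ext_one_tau (R : Presentation Y) (h : Subsingleton (Abelian.Ext Y X 1)) :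
    Subsingleton (Abelian.Ext X (R.tau k) 1) :=
  have := nakayama_injective (k := k) R.P₂
  ext_one_of_copresentation (kerι_injective _) (exact_kerι _) R.nakayamaMap_comp_eq_zero
    ((exists_extension_iff_exists_lifting_nakayama k R.d₂ R.d₁ X).1
      ((ext_one_iff_of_presentation R.exact₁ R.exact₀ R.surjective).1 h))

/-- The hypothesis is exactness of Hom(-, Λ) at P₁, and D is exact. -/
theorem exact_nakayamaMap {P₂ P₁ P₀ : ModuleCat.{u} Λᵐᵒᵖ} {d₂ : P₂ ⟶ P₁} {d₁ : P₁ ⟶ P₀}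
    (h0 : d₂ ≫ d₁ = 0)
    (h : ∀ φ : P₁ ⟶ regular Λ, d₂ ≫ φ = 0 → ∃ ψ : P₀ ⟶ regular Λ, d₁ ≫ ψ = φ) :
    Function.Exact (nakayamaMap k d₂) (nakayamaMap k d₁) := by
  intro x
  constructor
  · intro hx
    obtain ⟨y, hy⟩ := exists_comp_eq_of_ker_le ((homToAlgebra d₂).restrictScalars k)
      (KDual.toLinearMap x) fun g hg => by
        obtain ⟨ψ, hψ⟩ := h (ModuleCat.ofHom g) (ModuleCat.hom_ext hg)
        have hg' : g = ψ.hom.comp d₁.hom := (congrArg ModuleCat.Hom.hom hψ).symm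
        rw [hg']
        exact congrArg (fun z => KDual.toLinearMap z ψ.hom) hx
    exact ⟨y, hy⟩
  · rintro ⟨y, rfl⟩
    have := congrArg (fun f => f y) (nakayamaMap_comp (k := k) d₂ d₁)
    rw [h0, nakayamaMap_zero] at this
    exact this.symm

theorem Presentation.exact_nakayamaMap (R : Presentation Y)
    (h : Subsingleton (Abelian.Ext Y (regular Λ) 1)) :
    Function.Exact (nakayamaMap k R.d₂) (nakayamaMap k R.d₁) :=
  HigherAR.exact_nakayamaMap (comp_eq_zero_of_exact R.exact₁)
    ((ext_one_iff_of_presentation R.exact₁ R.exact₀ R.surjective).1 h)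

/-- Ext¹(Y, Λ) = 0 makes νP₂ → νP₁ → νP₀ exact, so the passage from Y to its translate can be
reversed. -/
theorem Presentation.ext_one_of_ext_one_tau (R : Presentation Y)
    (h : Subsingleton (Abelian.Ext Y (regular Λ) 1))
    (hX : Subsingleton (Abelian.Ext X (R.tau k) 1)) : Subsingleton (Abelian.Ext Y X 1) :=
  (ext_one_iff_of_presentation R.exact₁ R.exact₀ R.surjective).2
    ((exists_extension_iff_exists_lifting_nakayama k R.d₂ R.d₁ X).2
      (exists_lifting_of_copresentation (kerι_injective _) (exact_kerι _)
        (R.exact_nakayamaMap h) hX))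

theorem exact_comp_iso_hom {R : Type u} [Ring R] {A B C D : ModuleCat.{u} R} {f : A ⟶ B}
    {g : B ⟶ C} (h : Function.Exact f g) (e : C ≅ D) : Function.Exact f (g ≫ e.hom) :=
  (exact_comp_injective_iff ((ModuleCat.mono_iff_injective e.hom).1 inferInstance)).2 h

theorem surjective_hom_of_iso {R : Type u} [Ring R] {A B : ModuleCat.{u} R} (e : A ≅ B) :
    Function.Surjective e.hom :=
  (ModuleCat.epi_iff_surjective e.hom).1 inferInstance

/-- A higher translate is computed by a presentation whose last step is a projective cover. -/
theorem exists_presentation_of_isHigherARTranslate (h : IsHigherARTranslate k 2 Y X) :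
    ∃ R : Presentation Y, Nonempty (X ≅ R.tau k) ∧ ∃ (K : ModuleCat.{u} Λᵐᵒᵖ) (q : R.P₂ ⟶ K)
      (j : K ⟶ R.P₁), IsProjectiveCover q ∧ Function.Injective j ∧ Function.Exact j R.d₁ ∧
        q ≫ j = R.d₂ := by
  obtain ⟨Z, ⟨Z', ⟨e⟩, P₀, p, hp, ⟨e'⟩⟩, P₁, P₂, p', q, hp', hq, he⟩ := h
  have hex : Function.Exact (kerι p') (p' ≫ e'.hom ≫ kerι p) := by
    rw [← Category.assoc]
    exact (exact_comp_injective_iff (kerι_injective p)).2 (exact_comp_iso_hom (exact_kerι p') e')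
  let R : Presentation Y :=
    { P₂ := P₂
      P₁ := P₁
      P₀ := P₀
      d₂ := q ≫ kerι p'
      d₁ := p' ≫ e'.hom ≫ kerι p
      p := p ≫ e.inv
      finite₂ := hq.finite
      finite₁ := hp'.finite
      finite₀ := hp.finite
      projective₂ := hq.projective
      projective₁ := hp'.projective
      projective₀ := hp.projective
      exact₁ := (exact_comp_surjective_iff hq.surjective).2 hex
      exact₀ := (exact_comp_surjective_iff hp'.surjective).2
        ((exact_comp_surjective_iff (surjective_hom_of_iso e')).2
          (exact_comp_iso_hom (exact_kerι p) e.symm))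
      surjective := (surjective_hom_of_iso e.symm).comp hp.surjective }
  exact ⟨R, he, _, q, kerι p', hq, kerι_injective p', hex, rfl⟩

theorem ext_one_of_iso_right {R : Type u} [Ring R] {X Y Y' : ModuleCat.{u} R} (e : Y ≅ Y')
    (h : Subsingleton (Abelian.Ext X Y' 1)) : Subsingleton (Abelian.Ext X Y 1) :=
  ext_one_of_sum_right (ι := Unit) (fun _ => e.hom) (fun _ => e.inv) (by simp) fun _ => h

theorem ext_one_isHigherARTranslate {W : ModuleCat.{u} Λᵐᵒᵖ} (hY : IsHigherARTranslate k 2 Y X)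
    (h : Subsingleton (Abelian.Ext Y W 1)) : Subsingleton (Abelian.Ext W X 1) := by
  obtain ⟨R, ⟨e⟩, -⟩ := exists_presentation_of_isHigherARTranslate hY
  exact ext_one_of_iso_right e (R.ext_one_tau h)

theorem ext_one_dualAlgebra (X : ModuleCat.{u} Λᵐᵒᵖ) :
    Subsingleton (Abelian.Ext X (dualAlgebra k Λ) 1) :=
  have := dualAlgebra_injective (k := k) (Λ := Λ)
  subsingleton_of_forall_eq 0 Abelian.Ext.eq_zero_of_injective

/-- For X = τ₂W and Y = τ₂Z, Ext¹(W, Z) = 0 gives Ext¹(Z, τ₂W) = 0 and then Ext¹(τ₂W, τ₂Z) = 0. Both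
indices drop by one until one of the modules is DΛ; if that is X, one use of the implication moves
it into the second argument. -/
theorem ext_one_isIteratedTranslate : ∀ (i j : ℕ) {X Y : ModuleCat.{u} Λᵐᵒᵖ},
    IsIteratedTranslate k 2 i (dualAlgebra k Λ) X → IsIteratedTranslate k 2 j (dualAlgebra k Λ) Y →
      Subsingleton (Abelian.Ext X Y 1)
  | _, 0, _, _, _, ⟨e⟩ => ext_one_of_iso_right e.symm (ext_one_dualAlgebra _)
  | 0, _ + 1, _, _, ⟨e⟩, ⟨_, _, hZ⟩ => ext_one_isHigherARTranslate hZ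
      (ext_one_of_iso_right e.symm (ext_one_dualAlgebra _))
  | i + 1, j + 1, _, _, ⟨_, hW, hW'⟩, ⟨_, hZ, hZ'⟩ => ext_one_isHigherARTranslate hZ'
      (ext_one_isHigherARTranslate hW' (ext_one_isIteratedTranslate i j hW hZ))

variable [FiniteDimensional k Λ]

theorem finite_of_injective (k : Type u) [Field k] [Algebra k Λ] [FiniteDimensional k Λ]
    [Module.Finite Λᵐᵒᵖ Y] (f : X ⟶ Y) (hf : Function.Injective f) :
    Module.Finite Λᵐᵒᵖ X :=
  have := isNoetherianRing_mulOpposite k Λ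
  Module.Finite.of_injective f.hom hf

theorem Presentation.finite_tau (R : Presentation Y) : Module.Finite Λᵐᵒᵖ (R.tau k) :=
  have := finite_nakayama (k := k) R.P₂
  finite_of_injective k (kerι (nakayamaMap k R.d₂)) (kerι_injective _)

theorem finite_of_isHigherARTranslate (h : IsHigherARTranslate k 2 Y X) :
    Module.Finite Λᵐᵒᵖ X := by
  obtain ⟨R, ⟨e⟩, -⟩ := exists_presentation_of_isHigherARTranslate h
  have := R.finite_tau (k := k)
  exact finite_of_surjective e.inv (surjective_hom_of_iso e.symm)

theorem finite_of_isIteratedTranslate {i : ℕ}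
    (h : IsIteratedTranslate k 2 i (dualAlgebra k Λ) X) : Module.Finite Λᵐᵒᵖ X := by
  cases i with
  | zero =>
    obtain ⟨e⟩ := h
    have := finite_dualAlgebra (k := k) (Λ := Λ)
    exact finite_of_surjective e.hom (surjective_hom_of_iso e)
  | succ i =>
    obtain ⟨Z, -, hZ⟩ := h
    exact finite_of_isHigherARTranslate hZ

theorem isRigid_tauClosure : IsRigid 2 (tauClosure k Λ 2) where
  finite X hX := finite_of_addClosure (fun _ ⟨_, h⟩ => finite_of_isIteratedTranslate h) hX
  ext_eq_zero X Y hX hY i h0 h2 := by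
    obtain rfl : i = 1 := by omega
    exact ext_one_addClosure (fun _ _ ⟨i, hi⟩ ⟨j, hj⟩ => ext_one_isIteratedTranslate i j hi hj)
      hX hY

end Presentation

/-! ### Projective covers and existence of translates -/

section ProjectiveCover

variable {Λ : Type u} [Ring Λ]

/-- A projective surjecting onto X with least k-dimension is a cover: if N + Ker p = P, Fitting's
lemma yields a summand of P contained in N that still surjects onto X, and minimality makes it all
of P. -/
theorem exists_isProjectiveCover (k : Type u) [Field k] [Algebra k Λ]
    [FiniteDimensional k Λ] (X : ModuleCat.{u} Λᵐᵒᵖ) [Module.Finite Λᵐᵒᵖ X] :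
    ∃ (P : ModuleCat.{u} Λᵐᵒᵖ) (p : P ⟶ X), IsProjectiveCover p := by
  classical
  have := isNoetherianRing_mulOpposite k Λ
  have := isArtinianRing_mulOpposite k Λ
  have hex : ∃ n : ℕ, ∃ (P : ModuleCat.{u} Λᵐᵒᵖ) (p : P ⟶ X), Module.Finite Λᵐᵒᵖ P ∧
      Module.Projective Λᵐᵒᵖ P ∧ Function.Surjective p ∧ Module.finrank k P = n := by
    obtain ⟨n, f, hf⟩ := Module.Finite.exists_fin' Λᵐᵒᵖ X
    exact ⟨_, ModuleCat.of Λᵐᵒᵖ (Fin n → Λᵐᵒᵖ), ModuleCat.ofHom f,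
      inferInstanceAs (Module.Finite Λᵐᵒᵖ (Fin n → Λᵐᵒᵖ)),
      inferInstanceAs (Module.Projective Λᵐᵒᵖ (Fin n → Λᵐᵒᵖ)), hf, rfl⟩
  obtain ⟨P, p, hfin, hproj, hsurj, hrank⟩ := Nat.find_spec hex
  refine ⟨P, p, hfin, hproj, hsurj, fun N hN => ?_⟩
  have hNs : Function.Surjective (p.hom.comp N.subtype) := by
    intro x
    obtain ⟨y, rfl⟩ := hsurj x
    obtain ⟨n, hn, z, hz, rfl⟩ := Submodule.mem_sup.1 (hN ▸ Submodule.mem_top : y ∈ N ⊔ _)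
    refine ⟨⟨n, hn⟩, ?_⟩
    change p n = p (n + z)
    rw [map_add, show p z = 0 from hz, add_zero]
  obtain ⟨f₀, hf₀⟩ := Module.projective_lifting_property (p.hom.comp N.subtype) p.hom hNs
  let f : Module.End Λᵐᵒᵖ P := N.subtype.comp f₀
  have hpf : ∀ m : ℕ, p.hom.comp (f ^ m) = p.hom := by
    intro m
    induction m with
    | zero => rfl
    | succ m ih =>
      rw [pow_succ, Module.End.mul_eq_comp, ← LinearMap.comp_assoc, ih]
      exact hf₀
  -- The Fitting decomposition makes the range of f ^ m a summand; m ≥ 1 is what places this range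
  -- inside N.
  obtain ⟨m, hm1, hm⟩ := ((Filter.eventually_ge_atTop 1).and
    (LinearMap.eventually_isCompl_ker_pow_range_pow f)).exists
  let Q : ModuleCat.{u} Λᵐᵒᵖ := ModuleCat.of Λᵐᵒᵖ (LinearMap.range (f ^ m))
  let j : Q ⟶ P := ModuleCat.ofHom (LinearMap.range (f ^ m)).subtype
  have hj : Function.Injective j := Subtype.val_injective
  have hQf : Module.Finite Λᵐᵒᵖ Q := finite_of_injective k j hj
  have hQp : Module.Projective Λᵐᵒᵖ Q :=
    Module.Projective.of_split j.hom (Submodule.projectionOnto _ _ hm.symm)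
      (Submodule.projectionOnto_comp_subtype hm.symm)
  have hQs : Function.Surjective (j ≫ p) := by
    intro x
    obtain ⟨y, rfl⟩ := hsurj x
    exact ⟨⟨(f ^ m) y, y, rfl⟩, LinearMap.congr_fun (hpf m) y⟩
  have hle := Nat.find_min' hex ⟨Q, j ≫ p, hQf, hQp, hQs, rfl⟩
  rw [← hrank] at hle
  have := finiteDimensional_of_finite k P
  have := finiteDimensional_of_finite k Q
  have hinj : Function.Injective (j.hom.restrictScalars k) := hj
  have hsur : Function.Surjective (j.hom.restrictScalars k) :=
    (LinearMap.injective_iff_surjective_of_finrank_eq_finrank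
      (le_antisymm (LinearMap.finrank_le_finrank_of_injective hinj) hle)).1 hinj
  refine eq_top_iff.2 fun y _ => ?_
  obtain ⟨⟨_, z, rfl⟩, rfl⟩ := hsur y
  obtain ⟨m, rfl⟩ := Nat.exists_eq_add_of_le' hm1
  change (f ^ (m + 1)) z ∈ N
  rw [pow_succ', Module.End.mul_apply]
  exact (f₀ _).2

theorem exists_isHigherARTranslate (k : Type u) [Field k] [Algebra k Λ]
    [FiniteDimensional k Λ] (Y : ModuleCat.{u} Λᵐᵒᵖ) [Module.Finite Λᵐᵒᵖ Y] :
    ∃ X : ModuleCat.{u} Λᵐᵒᵖ, IsHigherARTranslate k 2 Y X := by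
  obtain ⟨P₀, p, hp⟩ := exists_isProjectiveCover k Y
  have := hp.finite
  have := finite_of_injective k (kerι p) (kerι_injective p)
  obtain ⟨P₁, p', hp'⟩ := exists_isProjectiveCover k (ModuleCat.of Λᵐᵒᵖ (LinearMap.ker p.hom))
  have := hp'.finite
  have := finite_of_injective k (kerι p') (kerι_injective p')
  obtain ⟨P₂, q, hq⟩ := exists_isProjectiveCover k (ModuleCat.of Λᵐᵒᵖ (LinearMap.ker p'.hom))
  exact ⟨_, _, ⟨Y, ⟨Iso.refl Y⟩, P₀, p, hp, ⟨Iso.refl _⟩⟩, P₁, P₂, p', q, hp', hq, ⟨Iso.refl _⟩⟩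

/-- The range of a section of p supplements the superfluous kernel, hence is all of P, and p is
injective on it. -/
theorem IsProjectiveCover.injective_of_projective {R : Type u} [Ring R] {P X : ModuleCat.{u} R}
    {p : P ⟶ X} (hp : IsProjectiveCover p) [Module.Projective R X] : Function.Injective p := by
  obtain ⟨s, hs⟩ := Module.projective_lifting_property p.hom LinearMap.id hp.surjective
  have hs' : ∀ x, p.hom (s x) = x := LinearMap.congr_fun hs
  have htop : LinearMap.range s = ⊤ := hp.superfluous _ (eq_top_iff.2 fun y _ =>
    Submodule.mem_sup.2 ⟨s (p.hom y), ⟨_, rfl⟩, y - s (p.hom y), by simp [hs'], by simp⟩)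
  refine (injective_iff_map_eq_zero p.hom).2 fun y hy => ?_
  obtain ⟨x, rfl⟩ := LinearMap.range_eq_top.1 htop y
  rw [hs'] at hy
  rw [hy, map_zero]

end ProjectiveCover

end HigherAR

namespace HigherAR

open scoped ModuleCat

/-! ### Consequences of global dimension at most two -/

section GlobalDimension

variable {R : Type u} [Ring R]

theorem exact_mkQ_range {A B : ModuleCat.{u} R} (f : A ⟶ B) :
    Function.Exact f (ModuleCat.ofHom (LinearMap.range f.hom).mkQ) :=
  LinearMap.exact_map_mkQ_range f.hom

theorem GlobalDimensionLE.projective_of_exact (hgl : GlobalDimensionLE R 2)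
    {K P₁ P₀ Y : ModuleCat.{u} R} [Projective P₁] [Projective P₀] {j : K ⟶ P₁} {d : P₁ ⟶ P₀}
    {p : P₀ ⟶ Y} (hj : Function.Injective j) (h₁ : Function.Exact j d) (h₀ : Function.Exact d p)
    (hp : Function.Surjective p) : Projective K := by
  obtain ⟨C, q, i, hq, hi, rfl⟩ := exists_image_factorization d
  have hY : HasProjectiveDimensionLT Y (1 + 2) := hgl Y
  have hC : HasProjectiveDimensionLT C (0 + 2) :=
    ((shortExact_of_functionExact hi ((exact_comp_surjective_iff hq).1 h₀)
      hp).hasProjectiveDimensionLT_X₃_iff 1 ‹_›).1 hY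
  have hK : HasProjectiveDimensionLT K (0 + 1) :=
    ((shortExact_of_functionExact hj ((exact_comp_injective_iff hi).1 h₁)
      hq).hasProjectiveDimensionLT_X₃_iff 0 ‹_›).1 hC
  exact projective_iff_hasProjectiveDimensionLT_one.2 hK

/-- Injective dimension is detected by Ext³(Y, X), which vanishes because every Y has projective
dimension at most two. -/
theorem GlobalDimensionLE.hasInjectiveDimensionLT (hgl : GlobalDimensionLE R 2)
    (X : ModuleCat.{u} R) : HasInjectiveDimensionLT X 3 :=
  hasInjectiveDimensionLT_of_enoughProjectives X 3 fun Y =>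
    have : HasProjectiveDimensionLT Y 3 := hgl Y
    HasProjectiveDimensionLT.subsingleton Y 3 3 le_rfl X

theorem GlobalDimensionLE.injective_of_exact (hgl : GlobalDimensionLE R 2)
    {X I₂ I₁ C : ModuleCat.{u} R} [Injective I₂] [Injective I₁] {i : X ⟶ I₂} {e : I₂ ⟶ I₁}
    {g : I₁ ⟶ C} (hi : Function.Injective i) (h₂ : Function.Exact i e) (h₁ : Function.Exact e g)
    (hg : Function.Surjective g) : Injective C := by
  obtain ⟨D, q, j, hq, hj, rfl⟩ := exists_image_factorization e
  have hX : HasInjectiveDimensionLT X (1 + 2) := hgl.hasInjectiveDimensionLT X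
  have hD : HasInjectiveDimensionLT D (0 + 2) :=
    ((shortExact_of_functionExact hi ((exact_comp_injective_iff hj).1 h₂)
      hq).hasInjectiveDimensionLT_X₃_iff 1 ‹_›).2 hX
  have hC : HasInjectiveDimensionLT C (0 + 1) :=
    ((shortExact_of_functionExact hj ((exact_comp_surjective_iff hq).1 h₁)
      hg).hasInjectiveDimensionLT_X₃_iff 0 ‹_›).2 hD
  exact injective_iff_hasInjectiveDimensionLT_one.2 hC

end GlobalDimension

/-! ### Functoriality of τ₂ on resolutions of length two -/

section Resolution

variable {k : Type u} [Field k] {Λ : Type u} [Ring Λ] [Algebra k Λ]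

/-- The second syzygy is already projective, so its projective cover P₂ is injective onto it. -/
theorem exists_resolution_of_isHigherARTranslate (hgl : GlobalDimensionLE Λᵐᵒᵖ 2)
    {X Y : ModuleCat.{u} Λᵐᵒᵖ} (h : IsHigherARTranslate k 2 Y X) :
    ∃ R : Presentation Y, Function.Injective R.d₂ ∧ Nonempty (X ≅ R.tau k) := by
  obtain ⟨R, he, K, q, j, hq, hj, hjd, hqj⟩ := exists_presentation_of_isHigherARTranslate h
  have := hgl.projective_of_exact hj hjd R.exact₀ R.surjective
  have hK : Module.Projective Λᵐᵒᵖ K := K.projective_of_module_projective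
  refine ⟨R, ?_, he⟩
  rw [← hqj]
  exact hj.comp hq.injective_of_projective

variable {Y Y' Y'' : ModuleCat.{u} Λᵐᵒᵖ}

/-- `(φ₂, φ₁, φ₀)` lifts `f` to a morphism of presentations. -/
structure IsLift {S : Type u} [Ring S] {Y Y' : ModuleCat.{u} S} (R : Presentation Y)
    (R' : Presentation Y') (f : Y ⟶ Y') (φ₂ : R.P₂ ⟶ R'.P₂)
    (φ₁ : R.P₁ ⟶ R'.P₁) (φ₀ : R.P₀ ⟶ R'.P₀) : Prop where
  comm₀ : φ₀ ≫ R'.p = R.p ≫ f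
  comm₁ : φ₁ ≫ R'.d₁ = R.d₁ ≫ φ₀
  comm₂ : φ₂ ≫ R'.d₂ = R.d₂ ≫ φ₁

theorem exists_isLift (R : Presentation Y) (R' : Presentation Y') (f : Y ⟶ Y') :
    ∃ φ₂ φ₁ φ₀, IsLift R R' f φ₂ φ₁ φ₀ := by
  have : Epi R'.p := (ModuleCat.epi_iff_surjective _).2 R'.surjective
  have h₀ : Projective.factorThru (R.p ≫ f) R'.p ≫ R'.p = R.p ≫ f :=
    Projective.factorThru_comp _ _
  obtain ⟨φ₁, h₁⟩ := exists_lift_of_exact R'.exact₀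
    (R.d₁ ≫ Projective.factorThru (R.p ≫ f) R'.p) (by
      rw [Category.assoc, h₀, ← Category.assoc, comp_eq_zero_of_exact R.exact₀, Limits.zero_comp])
  obtain ⟨φ₂, h₂⟩ := exists_lift_of_exact R'.exact₁ (R.d₂ ≫ φ₁) (by
      rw [Category.assoc, h₁, ← Category.assoc, comp_eq_zero_of_exact R.exact₁, Limits.zero_comp])
  exact ⟨φ₂, φ₁, _, h₀, h₁, h₂⟩

/-- A lift of zero to a resolution of length two is, in degree two, a multiple of the
differential. -/
theorem IsLift.exists_eq_of_zero {R : Presentation Y} {R' : Presentation Y'} {φ₂ φ₁ φ₀}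
    (h : IsLift R R' 0 φ₂ φ₁ φ₀) (hR' : Function.Injective R'.d₂) :
    ∃ η : R.P₁ ⟶ R'.P₂, R.d₂ ≫ η = φ₂ := by
  obtain ⟨η₀, h₀⟩ := exists_lift_of_exact R'.exact₀ φ₀ (by rw [h.comm₀, Limits.comp_zero])
  obtain ⟨η₁, h₁⟩ := exists_lift_of_exact R'.exact₁ (φ₁ - R.d₁ ≫ η₀) (by
    rw [Preadditive.sub_comp, h.comm₁, Category.assoc, h₀, sub_self])
  have : Mono R'.d₂ := (ModuleCat.mono_iff_injective _).2 hR'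
  refine ⟨η₁, (cancel_mono R'.d₂).1 ?_⟩
  rw [Category.assoc, h₁, h.comm₂, Preadditive.comp_sub, ← Category.assoc R.d₂ R.d₁,
    comp_eq_zero_of_exact R.exact₁, Limits.zero_comp, sub_zero]

variable (k) in
/-- `t` is induced by `f` on the kernels `tau`. -/
def IsTauMap (R : Presentation Y) (R' : Presentation Y') (f : Y ⟶ Y')
    (t : R.tau k ⟶ R'.tau k) : Prop :=
  ∃ φ₂ φ₁ φ₀, IsLift R R' f φ₂ φ₁ φ₀ ∧
    t ≫ kerι (nakayamaMap k R'.d₂) = kerι (nakayamaMap k R.d₂) ≫ nakayamaMap k φ₂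

theorem exists_isTauMap (R : Presentation Y) (R' : Presentation Y') (f : Y ⟶ Y') :
    ∃ t, IsTauMap k R R' f t := by
  obtain ⟨φ₂, φ₁, φ₀, h⟩ := exists_isLift R R' f
  obtain ⟨t, ht⟩ := exists_kerLift (nakayamaMap k R'.d₂)
    (kerι (nakayamaMap k R.d₂) ≫ nakayamaMap k φ₂) (by
      rw [Category.assoc, ← nakayamaMap_comp, h.comm₂, nakayamaMap_comp, ← Category.assoc,
        kerι_comp, Limits.zero_comp])
  exact ⟨t, φ₂, φ₁, φ₀, h, ht⟩

theorem IsTauMap.id (R : Presentation Y) : IsTauMap k R R (𝟙 Y) (𝟙 _) :=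
  ⟨𝟙 _, 𝟙 _, 𝟙 _, ⟨by simp, by simp, by simp⟩, rfl⟩

theorem IsTauMap.comp {R : Presentation Y} {R' : Presentation Y'} {R'' : Presentation Y''}
    {f : Y ⟶ Y'} {g : Y' ⟶ Y''} {t : R.tau k ⟶ R'.tau k} {s : R'.tau k ⟶ R''.tau k}
    (ht : IsTauMap k R R' f t) (hs : IsTauMap k R' R'' g s) :
    IsTauMap k R R'' (f ≫ g) (t ≫ s) := by
  obtain ⟨φ₂, φ₁, φ₀, h, ht⟩ := ht
  obtain ⟨ψ₂, ψ₁, ψ₀, h', hs⟩ := hs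
  refine ⟨φ₂ ≫ ψ₂, φ₁ ≫ ψ₁, φ₀ ≫ ψ₀, ⟨?_, ?_, ?_⟩, ?_⟩
  · rw [Category.assoc, h'.comm₀, ← Category.assoc, h.comm₀, Category.assoc]
  · rw [Category.assoc, h'.comm₁, ← Category.assoc, h.comm₁, Category.assoc]
  · rw [Category.assoc, h'.comm₂, ← Category.assoc, h.comm₂, Category.assoc]
  · rw [Category.assoc, hs, ← Category.assoc, ht, Category.assoc, nakayamaMap_comp]

theorem IsTauMap.sub {R : Presentation Y} {R' : Presentation Y'} {f g : Y ⟶ Y'}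
    {t s : R.tau k ⟶ R'.tau k} (ht : IsTauMap k R R' f t) (hs : IsTauMap k R R' g s) :
    IsTauMap k R R' (f - g) (t - s) := by
  obtain ⟨φ₂, φ₁, φ₀, h, ht⟩ := ht
  obtain ⟨ψ₂, ψ₁, ψ₀, h', hs⟩ := hs
  refine ⟨φ₂ - ψ₂, φ₁ - ψ₁, φ₀ - ψ₀, ⟨?_, ?_, ?_⟩, ?_⟩
  · rw [Preadditive.sub_comp, h.comm₀, h'.comm₀, Preadditive.comp_sub]
  · rw [Preadditive.sub_comp, h.comm₁, h'.comm₁, Preadditive.comp_sub]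
  · rw [Preadditive.sub_comp, h.comm₂, h'.comm₂, Preadditive.comp_sub]
  · rw [Preadditive.sub_comp, ht, hs, nakayamaMap_sub, Preadditive.comp_sub]

theorem IsTauMap.add {R : Presentation Y} {R' : Presentation Y'} {f g : Y ⟶ Y'}
    {t s : R.tau k ⟶ R'.tau k} (ht : IsTauMap k R R' f t) (hs : IsTauMap k R R' g s) :
    IsTauMap k R R' (f + g) (t + s) := by
  obtain ⟨φ₂, φ₁, φ₀, h, ht⟩ := ht
  obtain ⟨ψ₂, ψ₁, ψ₀, h', hs⟩ := hs
  refine ⟨φ₂ + ψ₂, φ₁ + ψ₁, φ₀ + ψ₀, ⟨?_, ?_, ?_⟩, ?_⟩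
  · rw [Preadditive.add_comp, h.comm₀, h'.comm₀, Preadditive.comp_add]
  · rw [Preadditive.add_comp, h.comm₁, h'.comm₁, Preadditive.comp_add]
  · rw [Preadditive.add_comp, h.comm₂, h'.comm₂, Preadditive.comp_add]
  · rw [Preadditive.add_comp, ht, hs, nakayamaMap_add, Preadditive.comp_add]

theorem IsTauMap.zero (R : Presentation Y) (R' : Presentation Y') : IsTauMap k R R' 0 0 := by
  obtain ⟨t, ht⟩ := exists_isTauMap (k := k) R R' 0
  simpa using ht.sub ht

theorem IsTauMap.sum {R : Presentation Y} {R' : Presentation Y'} {ι : Type*} (s : Finset ι)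
    {f : ι → (Y ⟶ Y')} {t : ι → (R.tau k ⟶ R'.tau k)} (h : ∀ i, IsTauMap k R R' (f i) (t i)) :
    IsTauMap k R R' (∑ i ∈ s, f i) (∑ i ∈ s, t i) := by
  classical
  induction s using Finset.induction_on with
  | empty => exact IsTauMap.zero R R'
  | insert i s hi ih =>
    rw [Finset.sum_insert hi, Finset.sum_insert hi]
    exact (h i).add ih

/-- In degree two a lift of zero factors through d₂, and ν d₂ vanishes on its kernel. With
additivity this makes the induced map independent of the lift. -/
theorem IsTauMap.eq_zero {R : Presentation Y} {R' : Presentation Y'}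
    {t : R.tau k ⟶ R'.tau k} (ht : IsTauMap k R R' 0 t) (hR' : Function.Injective R'.d₂) :
    t = 0 := by
  obtain ⟨φ₂, φ₁, φ₀, h, ht⟩ := ht
  obtain ⟨η, rfl⟩ := h.exists_eq_of_zero hR'
  refine kerι_cancel ?_
  rw [ht, nakayamaMap_comp, ← Category.assoc, kerι_comp, Limits.zero_comp, Limits.zero_comp]

theorem IsTauMap.unique {R : Presentation Y} {R' : Presentation Y'} {f : Y ⟶ Y'}
    {t s : R.tau k ⟶ R'.tau k} (ht : IsTauMap k R R' f t) (hs : IsTauMap k R R' f s)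
    (hR' : Function.Injective R'.d₂) : t = s := by
  have := ht.sub hs
  rw [sub_self] at this
  exact sub_eq_zero.1 (this.eq_zero hR')

/-- A decomposition of the identity of `Y` induces one on `tau`. -/
theorem exists_tau_decomposition (R : Presentation Y) (hR : Function.Injective R.d₂) {ι : Type*}
    [Fintype ι] {Z : ι → ModuleCat.{u} Λᵐᵒᵖ} (R' : ∀ i, Presentation (Z i)) (a : ∀ i, Y ⟶ Z i)
    (b : ∀ i, Z i ⟶ Y) (hab : ∑ i, a i ≫ b i = 𝟙 Y) :
    ∃ (a' : ∀ i, R.tau k ⟶ (R' i).tau k) (b' : ∀ i, (R' i).tau k ⟶ R.tau k),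
      ∑ i, a' i ≫ b' i = 𝟙 _ := by
  choose a' ha' using fun i => exists_isTauMap (k := k) R (R' i) (a i)
  choose b' hb' using fun i => exists_isTauMap (k := k) (R' i) R (b i)
  refine ⟨a', b', ?_⟩
  have := IsTauMap.sum Finset.univ fun i => (ha' i).comp (hb' i)
  rw [hab] at this
  exact this.unique (IsTauMap.id R) hR

/-- `tau` does not depend on the resolution. -/
theorem nonempty_tau_iso (e : Y ≅ Y') (R : Presentation Y) (R' : Presentation Y')
    (hR : Function.Injective R.d₂) (hR' : Function.Injective R'.d₂) :
    Nonempty (R.tau k ≅ R'.tau k) := by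
  obtain ⟨t, ht⟩ := exists_isTauMap (k := k) R R' e.hom
  obtain ⟨s, hs⟩ := exists_isTauMap (k := k) R' R e.inv
  refine ⟨⟨t, s, ?_, ?_⟩⟩
  · have := ht.comp hs
    rw [e.hom_inv_id] at this
    exact this.unique (IsTauMap.id R) hR
  · have := hs.comp ht
    rw [e.inv_hom_id] at this
    exact this.unique (IsTauMap.id R') hR'

variable [FiniteDimensional k Λ]

theorem exists_resolution (k : Type u) [Field k] [Algebra k Λ] [FiniteDimensional k Λ]
    (hgl : GlobalDimensionLE Λᵐᵒᵖ 2) (Y : ModuleCat.{u} Λᵐᵒᵖ)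
    [Module.Finite Λᵐᵒᵖ Y] : ∃ R : Presentation Y, Function.Injective R.d₂ := by
  obtain ⟨X, hX⟩ := exists_isHigherARTranslate k Y
  obtain ⟨R, hR, -⟩ := exists_resolution_of_isHigherARTranslate hgl hX
  exact ⟨R, hR⟩

/-- As ν is fully faithful, a morphism νΛ ⟶ Ker(ν d₂) comes from some f : Λ ⟶ P₂ with f ≫ d₂ = 0,
and d₂ is injective. -/
theorem hom_dualAlgebra_tau_eq_zero (R : Presentation Y) (hR : Function.Injective R.d₂)
    (g : dualAlgebra k Λ ⟶ R.tau k) : g = 0 := by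
  obtain ⟨f, hf⟩ := exists_nakayamaMap_eq
    (dualAlgebraIso.inv ≫ g ≫ kerι (nakayamaMap k R.d₂) : nakayama k Λ (regular Λ) ⟶ _)
  have : Mono R.d₂ := (ModuleCat.mono_iff_injective _).2 hR
  have hf0 : f = 0 := (cancel_mono R.d₂).1 (nakayamaMap_injective (k := k) (by
    rw [nakayamaMap_comp, hf, Category.assoc, Category.assoc, kerι_comp, Limits.comp_zero,
      Limits.comp_zero, Limits.zero_comp, nakayamaMap_zero]))
  rw [hf0, nakayamaMap_zero] at hf
  refine kerι_cancel ((cancel_epi dualAlgebraIso.inv).1 ?_)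
  rw [← hf, Limits.zero_comp, Limits.comp_zero]

/-- Every morphism between translates is induced, provided `Ext¹(Y, Λ) = 0`. -/
theorem exists_isTauMap_of_hom (R : Presentation Y) (R' : Presentation Y')
    (hY : Subsingleton (Abelian.Ext Y (regular Λ) 1)) (t : R.tau k ⟶ R'.tau k) :
    ∃ f : Y ⟶ Y', IsTauMap k R R' f t := by
  have := nakayama_injective (k := k) R'.P₂
  have := nakayama_injective (k := k) R'.P₁
  have := nakayama_injective (k := k) R'.P₀
  have : Mono (kerι (nakayamaMap k R.d₂)) :=
    (ModuleCat.mono_iff_injective _).2 (kerι_injective _)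
  -- Injectivity of the νP'ᵢ extends t along νP₂ → νP₁ → νP₀. Exactness at νP₁, the point where
  -- Ext¹(Y, Λ) = 0 enters, permits the last extension; full faithfulness of ν then returns a map of
  -- presentations.
  obtain ⟨ψ₂, h₂⟩ : ∃ ψ₂, kerι (nakayamaMap k R.d₂) ≫ ψ₂ = t ≫ kerι (nakayamaMap k R'.d₂) :=
    ⟨_, Injective.comp_factorThru _ _⟩
  obtain ⟨φ₂, rfl⟩ := exists_nakayamaMap_eq ψ₂
  obtain ⟨ψ₁, h₁⟩ := exists_desc_of_exact (exact_kerι (nakayamaMap k R.d₂))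
    (nakayamaMap k φ₂ ≫ nakayamaMap k R'.d₂) (by
      rw [← Category.assoc, h₂, Category.assoc, kerι_comp, Limits.comp_zero])
  obtain ⟨φ₁, rfl⟩ := exists_nakayamaMap_eq ψ₁
  obtain ⟨ψ₀, h₀⟩ := exists_desc_of_exact (R.exact_nakayamaMap (k := k) hY)
    (nakayamaMap k φ₁ ≫ nakayamaMap k R'.d₁) (by
      rw [← Category.assoc, h₁, Category.assoc, R'.nakayamaMap_comp_eq_zero, Limits.comp_zero])
  obtain ⟨φ₀, rfl⟩ := exists_nakayamaMap_eq ψ₀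
  have c₂ : φ₂ ≫ R'.d₂ = R.d₂ ≫ φ₁ := nakayamaMap_injective (k := k) h₁.symm
  have c₁ : φ₁ ≫ R'.d₁ = R.d₁ ≫ φ₀ := nakayamaMap_injective (k := k) h₀.symm
  obtain ⟨f, hf⟩ := exists_desc_of_surjective R.exact₀ R.surjective (φ₀ ≫ R'.p) (by
    rw [← Category.assoc, ← c₁, Category.assoc, comp_eq_zero_of_exact R'.exact₀,
      Limits.comp_zero])
  exact ⟨f, φ₂, φ₁, φ₀, ⟨hf.symm, c₁, c₂⟩, h₂.symm⟩

theorem hom_tau_eq_zero (R : Presentation Y) (R' : Presentation Y')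
    (hR' : Function.Injective R'.d₂) (hY : Subsingleton (Abelian.Ext Y (regular Λ) 1))
    (h : ∀ f : Y ⟶ Y', f = 0) (t : R.tau k ⟶ R'.tau k) : t = 0 := by
  obtain ⟨f, hf⟩ := exists_isTauMap_of_hom R R' hY t
  rw [h f] at hf
  exact hf.eq_zero hR'

theorem hom_projective_eq_zero (h : ∀ f : Y ⟶ regular Λ, f = 0) (P : ModuleCat.{u} Λᵐᵒᵖ)
    [Module.Finite Λᵐᵒᵖ P] [Module.Projective Λᵐᵒᵖ P] (f : Y ⟶ P) : f = 0 := by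
  obtain ⟨n, e, g, hg⟩ := exists_dualBasis P
  rw [← Category.comp_id f, ← sum_comp_fromRegular hg, Preadditive.comp_sum]
  refine Finset.sum_eq_zero fun i _ => ?_
  rw [← Category.assoc, h (f ≫ _), Limits.zero_comp]

/-- A lift of f that is zero on translates is null-homotopic. The homotopy is built on the ν side
from degree two downwards; the only obstruction left in degree zero is a morphism Y ⟶ P'₀, which
vanishes since Hom(Y, Λ) = 0. -/
theorem hom_eq_zero_of_hom_tau_eq_zero (R : Presentation Y) (R' : Presentation Y')
    (hY : Subsingleton (Abelian.Ext Y (regular Λ) 1))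
    (hY0 : ∀ f : Y ⟶ regular Λ, f = 0) (h : ∀ t : R.tau k ⟶ R'.tau k, t = 0) (f : Y ⟶ Y') :
    f = 0 := by
  obtain ⟨t, φ₂, φ₁, φ₀, hφ, ht⟩ := exists_isTauMap (k := k) R R' f
  rw [h t, Limits.zero_comp] at ht
  have := nakayama_injective (k := k) R'.P₂
  have := nakayama_injective (k := k) R'.P₁
  obtain ⟨s₁, hs₁⟩ := exists_desc_of_exact (exact_kerι (nakayamaMap k R.d₂)) (nakayamaMap k φ₂)
    ht.symm
  obtain ⟨η₁, rfl⟩ := exists_nakayamaMap_eq s₁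
  have c₂ : R.d₂ ≫ η₁ = φ₂ := nakayamaMap_injective (k := k) hs₁
  obtain ⟨s₀, hs₀⟩ := exists_desc_of_exact (R.exact_nakayamaMap (k := k) hY)
    (nakayamaMap k (φ₁ - η₁ ≫ R'.d₂)) (by
      rw [← nakayamaMap_comp, Preadditive.comp_sub, ← hφ.comm₂, ← Category.assoc, c₂, sub_self,
        nakayamaMap_zero])
  obtain ⟨η₀, rfl⟩ := exists_nakayamaMap_eq s₀
  have c₁ : R.d₁ ≫ η₀ = φ₁ - η₁ ≫ R'.d₂ := nakayamaMap_injective (k := k) hs₀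
  obtain ⟨v, hv⟩ := exists_desc_of_surjective R.exact₀ R.surjective (φ₀ - η₀ ≫ R'.d₁) (by
    rw [Preadditive.comp_sub, ← hφ.comm₁, ← Category.assoc, c₁, Preadditive.sub_comp,
      Category.assoc, comp_eq_zero_of_exact R'.exact₁, Limits.comp_zero, sub_zero, sub_self])
  rw [hom_projective_eq_zero hY0 _ v, Limits.comp_zero, eq_comm, sub_eq_zero] at hv
  have : Epi R.p := (ModuleCat.epi_iff_surjective _).2 R.surjective
  refine (cancel_epi R.p).1 ?_
  rw [← hφ.comm₀, hv, Category.assoc, comp_eq_zero_of_exact R'.exact₀, Limits.comp_zero,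
    Limits.comp_zero]

end Resolution

/-! ### Injective resolutions and the inverse translate -/

section InverseTranslate

variable {k : Type u} [Field k] {Λ : Type u} [Ring Λ] [Algebra k Λ] [FiniteDimensional k Λ]

theorem ext_one_of_iso_left {R : Type u} [Ring R] {X X' Y : ModuleCat.{u} R} (e : X ≅ X')
    (h : Subsingleton (Abelian.Ext X' Y 1)) : Subsingleton (Abelian.Ext X Y 1) :=
  ext_one_of_sum_left (ι := Unit) (fun _ => e.hom) (fun _ => e.inv) (by simp) fun _ => h

/-- A finitely generated module over an algebra of global dimension at most two has an injective
resolution `0 → X → ν P₂ → ν P₁ → ν P₀ → 0`. -/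
theorem exists_injective_resolution (k : Type u) [Field k] [Algebra k Λ] [FiniteDimensional k Λ]
    (hgl : GlobalDimensionLE Λᵐᵒᵖ 2) (X : ModuleCat.{u} Λᵐᵒᵖ) [Module.Finite Λᵐᵒᵖ X] :
    ∃ (P₂ P₁ P₀ : ModuleCat.{u} Λᵐᵒᵖ) (i : X ⟶ nakayama k Λ P₂) (d₂ : P₂ ⟶ P₁) (d₁ : P₁ ⟶ P₀),
      (Module.Finite Λᵐᵒᵖ P₂ ∧ Module.Projective Λᵐᵒᵖ P₂) ∧
      (Module.Finite Λᵐᵒᵖ P₁ ∧ Module.Projective Λᵐᵒᵖ P₁) ∧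
      (Module.Finite Λᵐᵒᵖ P₀ ∧ Module.Projective Λᵐᵒᵖ P₀) ∧
      Function.Injective i ∧ Function.Exact i (nakayamaMap k d₂) ∧
      Function.Exact (nakayamaMap k d₂) (nakayamaMap k d₁) ∧
      Function.Surjective (nakayamaMap k d₁) := by
  obtain ⟨P₂, i, _, _, hi⟩ := exists_embedding_nakayama k X
  have := finite_nakayama (k := k) P₂
  let C₁ := ModuleCat.of Λᵐᵒᵖ (nakayama k Λ P₂ ⧸ LinearMap.range i.hom)
  let π₁ : nakayama k Λ P₂ ⟶ C₁ := ModuleCat.ofHom (LinearMap.range i.hom).mkQ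
  have hπ₁ : Function.Surjective π₁ := Submodule.mkQ_surjective _
  have := finite_of_surjective π₁ hπ₁
  obtain ⟨P₁, j, _, _, hj⟩ := exists_embedding_nakayama k C₁
  have := finite_nakayama (k := k) P₁
  let C₂ := ModuleCat.of Λᵐᵒᵖ (nakayama k Λ P₁ ⧸ LinearMap.range j.hom)
  let π₂ : nakayama k Λ P₁ ⟶ C₂ := ModuleCat.ofHom (LinearMap.range j.hom).mkQ
  have hπ₂ : Function.Surjective π₂ := Submodule.mkQ_surjective _
  have := finite_of_surjective π₂ hπ₂
  have e₂ : Function.Exact i (π₁ ≫ j) := (exact_comp_injective_iff hj).2 (exact_mkQ_range i)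
  have e₁ : Function.Exact (π₁ ≫ j) π₂ := (exact_comp_surjective_iff hπ₁).2 (exact_mkQ_range j)
  have := nakayama_injective (k := k) P₂
  have := nakayama_injective (k := k) P₁
  have : Injective C₂ := hgl.injective_of_exact hi e₂ e₁ hπ₂
  obtain ⟨P₀, _, _, ⟨e⟩⟩ := exists_iso_nakayama_of_injective k C₂
  obtain ⟨d₂, hd₂⟩ := exists_nakayamaMap_eq (π₁ ≫ j)
  obtain ⟨d₁, hd₁⟩ := exists_nakayamaMap_eq (π₂ ≫ e.hom)
  refine ⟨P₂, P₁, P₀, i, d₂, d₁, ⟨‹_›, ‹_›⟩, ⟨‹_›, ‹_›⟩, ⟨‹_›, ‹_›⟩, hi, hd₂ ▸ e₂, ?_, ?_⟩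
  · rw [hd₁, hd₂]
    exact exact_comp_iso_hom e₁ e
  · rw [hd₁]
    exact (surjective_hom_of_iso e).comp hπ₂

/-- If `Ext¹(DΛ, X) = 0`, then `X` is the direct sum of an injective module and a translate. -/
theorem exists_inverse_translate (hgl : GlobalDimensionLE Λᵐᵒᵖ 2) (X : ModuleCat.{u} Λᵐᵒᵖ)
    [Module.Finite Λᵐᵒᵖ X] (hX : Subsingleton (Abelian.Ext (dualAlgebra k Λ) X 1)) :
    ∃ (Y : ModuleCat.{u} Λᵐᵒᵖ) (R : Presentation Y) (H : ModuleCat.{u} Λᵐᵒᵖ)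
      (a : X ⟶ nakayama k Λ H) (b : nakayama k Λ H ⟶ X) (c : X ⟶ R.tau k) (d : R.tau k ⟶ X),
      Module.Finite Λᵐᵒᵖ Y ∧ Function.Injective R.d₂ ∧ Module.Finite Λᵐᵒᵖ H ∧
      Module.Projective Λᵐᵒᵖ H ∧ a ≫ b + c ≫ d = 𝟙 X ∧ d ≫ c = 𝟙 _ ∧
      (∀ W, Subsingleton (Abelian.Ext W X 1) → Subsingleton (Abelian.Ext Y W 1)) ∧
      ∀ f : Y ⟶ regular Λ, f = 0 := by
  obtain ⟨P₂, P₁, P₀, i, d₂, d₁, ⟨_, _⟩, ⟨_, _⟩, ⟨_, _⟩, hi, e₂, e₁, hs⟩ :=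
    exists_injective_resolution k hgl X
  have hdd : d₂ ≫ d₁ = 0 := nakayamaMap_injective (k := k) (by
    rw [nakayamaMap_comp, comp_eq_zero_of_exact e₁, nakayamaMap_zero])
  have hid : i ≫ nakayamaMap k d₂ = 0 := comp_eq_zero_of_exact e₂
  -- An element of Ker d₁ is a morphism Λ ⟶ P₁; its image under ν is a morphism from νΛ ≅ DΛ, which
  -- lifts to νP₂ because Ext¹(DΛ, X) = 0.
  have hd : Function.Exact d₂ d₁ := by
    intro x
    constructor
    · intro hx
      obtain ⟨ψ, hψ⟩ := exists_lifting_of_copresentation hi e₂ e₁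
        (ext_one_of_iso_left dualAlgebraIso.symm hX) (nakayamaMap k (fromRegular x)) (by
          rw [← nakayamaMap_comp, fromRegular, actHom_comp, hx, ← nakayamaMap_zero]
          congr 1
          ext
          exact smul_zero _)
      obtain ⟨q, rfl⟩ := exists_nakayamaMap_eq ψ
      have hq : q ≫ d₂ = fromRegular x := nakayamaMap_injective (k := k) hψ
      refine ⟨q (1 : Λ), ?_⟩
      exact (congrArg (fun f : regular Λ ⟶ P₁ => f (1 : Λ)) hq).trans (fromRegular_apply_one x)
    · rintro ⟨y, rfl⟩
      exact congrArg (fun f : P₂ ⟶ P₀ => f y) hdd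
  let Y := ModuleCat.of Λᵐᵒᵖ (P₀ ⧸ LinearMap.range d₁.hom)
  let p : P₀ ⟶ Y := ModuleCat.ofHom (LinearMap.range d₁.hom).mkQ
  have hp : Function.Surjective p := Submodule.mkQ_surjective _
  have h₀ : Function.Exact d₁ p := exact_mkQ_range d₁
  -- The map d₂ need not be injective. Its image K is projective, so P₂ = K ⊕ Ker q; replacing P₂ by
  -- K gives a resolution of Y, and Ker q supplies the injective summand νH of X.
  let K := ModuleCat.of Λᵐᵒᵖ (LinearMap.ker d₁.hom)
  have hKp : Projective K := hgl.projective_of_exact (kerι_injective d₁) (exact_kerι d₁) h₀ hp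
  have hKp' : Module.Projective Λᵐᵒᵖ K := K.projective_of_module_projective
  have hKf : Module.Finite Λᵐᵒᵖ K := finite_of_injective k (kerι d₁) (kerι_injective d₁)
  obtain ⟨q, hq⟩ := exists_kerLift d₁ d₂ hdd
  have hqs : Function.Surjective q := by
    intro y
    obtain ⟨x, hx⟩ := (hd y.1).1 y.2
    exact ⟨x, Subtype.ext ((congrArg (fun f : P₂ ⟶ P₁ => f x) hq).trans hx)⟩
  have : Epi q := (ModuleCat.epi_iff_surjective q).2 hqs
  obtain ⟨s, hsq⟩ : ∃ s : K ⟶ P₂, s ≫ q = 𝟙 K := ⟨_, Projective.factorThru_comp (𝟙 K) q⟩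
  obtain ⟨r, hr⟩ := exists_kerLift q (𝟙 P₂ - q ≫ s) (by
    rw [Preadditive.sub_comp, Category.assoc, hsq, Category.id_comp, Category.comp_id, sub_self])
  have hrι : kerι q ≫ r = 𝟙 _ := kerι_cancel (by
    rw [Category.assoc, hr, Preadditive.comp_sub, ← Category.assoc, kerι_comp, Limits.zero_comp,
      Category.comp_id, Category.id_comp, sub_zero])
  let R : Presentation Y :=
    { P₂ := K
      P₁ := P₁
      P₀ := P₀
      d₂ := kerι d₁
      d₁ := d₁
      p := p
      finite₂ := hKf
      finite₁ := ‹_›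
      finite₀ := ‹_›
      projective₂ := hKp'
      projective₁ := ‹_›
      projective₀ := ‹_›
      exact₁ := exact_kerι d₁
      exact₀ := h₀
      surjective := hp }
  -- X is the kernel of ν d₂ on νP₂ = νK ⊕ ν(Ker q), and ν d₂ vanishes on the second summand; b, c,
  -- d are the restrictions of the structure maps of this splitting.
  obtain ⟨b, hb⟩ := exists_lift_of_injective e₂ hi (nakayamaMap k (kerι q)) (by
    rw [← hq, ← nakayamaMap_comp, ← Category.assoc, kerι_comp, Limits.zero_comp, nakayamaMap_zero])
  obtain ⟨c, hc⟩ := exists_kerLift (nakayamaMap k (kerι d₁)) (i ≫ nakayamaMap k q) (by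
    rw [Category.assoc, ← nakayamaMap_comp, hq, hid])
  obtain ⟨d, hd'⟩ := exists_lift_of_injective e₂ hi
    (kerι (nakayamaMap k (kerι d₁)) ≫ nakayamaMap k s) (by
      rw [Category.assoc, ← nakayamaMap_comp, ← hq, ← Category.assoc s, hsq, Category.id_comp,
        kerι_comp])
  have : Mono i := (ModuleCat.mono_iff_injective i).2 hi
  refine ⟨Y, R, ModuleCat.of Λᵐᵒᵖ (LinearMap.ker q.hom), i ≫ nakayamaMap k r, b, c, d,
    finite_of_surjective p hp, kerι_injective d₁, finite_of_injective k (kerι q) (kerι_injective q),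
    Module.Projective.of_split (kerι q).hom r.hom (by rw [← ModuleCat.hom_comp, hrι]; rfl),
    (cancel_mono i).1 ?_, kerι_cancel ?_, fun W hW => ?_, fun f => ?_⟩
  · rw [Preadditive.add_comp, Category.assoc, Category.assoc, hb, Category.assoc, hd',
      ← Category.assoc c, hc, Category.assoc, ← nakayamaMap_comp, ← nakayamaMap_comp, hr,
      ← Preadditive.comp_add, ← nakayamaMap_add, sub_add_cancel, nakayamaMap_id,
      Category.comp_id, Category.id_comp]
  · rw [Category.assoc, hc, ← Category.assoc, hd', Category.assoc, ← nakayamaMap_comp, hsq,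
      nakayamaMap_id, Category.comp_id, Category.id_comp]
  · exact (ext_one_iff_of_presentation hd h₀ hp).2
      ((exists_extension_iff_exists_lifting_nakayama k d₂ d₁ W).2
        (exists_lifting_of_copresentation hi e₂ e₁ hW))
  -- Surjectivity of ν d₁, the end of the injective resolution, cancels it from ν(d₁ ≫ p ≫ f) = 0.
  · have : Epi (nakayamaMap k d₁) := (ModuleCat.epi_iff_surjective _).2 hs
    have : Epi p := (ModuleCat.epi_iff_surjective p).2 hp
    refine (cancel_epi p).1 (nakayamaMap_injective (k := k) ((cancel_epi (nakayamaMap k d₁)).1 ?_))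
    rw [← nakayamaMap_comp, ← Category.assoc, comp_eq_zero_of_exact h₀, Limits.zero_comp,
      Limits.comp_zero, nakayamaMap_zero, nakayamaMap_zero, Limits.comp_zero]

end InverseTranslate

end HigherAR

namespace HigherAR

open scoped ModuleCat

/-! ### The additive closure of one object -/

section AddObject

variable {R : Type u} [Ring R]

theorem addObject_iff {M X : ModuleCat.{u} R} :
    addObject M X ↔ ∃ (m : ℕ) (a : Fin m → (X ⟶ M)) (b : Fin m → (M ⟶ X)),
      ∑ j, a j ≫ b j = 𝟙 X := by
  refine addClosure_iff.trans ⟨?_, ?_⟩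
  · rintro ⟨m, Z, a, b, hZ, hab⟩
    exact ⟨m, fun j => a j ≫ (hZ j).some.hom, fun j => (hZ j).some.inv ≫ b j, by simpa using hab⟩
  · rintro ⟨m, a, b, hab⟩
    exact ⟨m, fun _ => M, a, b, fun _ => ⟨Iso.refl M⟩, hab⟩

theorem addClosure_of_id_eq_zero {S : ObjectProperty (ModuleCat.{u} R)} {X : ModuleCat.{u} R}
    (h : 𝟙 X = 0) : addClosure S X :=
  addClosure_of_sum (ι := Empty) (Z := fun _ => X) (fun _ => 0) (fun _ => 0) (fun j => j.elim)
    (by simp [h])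

theorem addClosure_of_iso {S : ObjectProperty (ModuleCat.{u} R)} {X Y : ModuleCat.{u} R}
    (e : X ≅ Y) (hY : addClosure S Y) : addClosure S X :=
  addClosure_of_retract e.hom e.inv e.hom_inv_id hY

theorem addClosure_of_le {S S' : ObjectProperty (ModuleCat.{u} R)}
    (h : ∀ Z, S Z → addClosure S' Z) {X : ModuleCat.{u} R} (hX : addClosure S X) :
    addClosure S' X := by
  obtain ⟨m, Z, a, b, hZ, hab⟩ := addClosure_iff.1 hX
  exact addClosure_of_sum a b (fun j => h _ (hZ j)) hab

end AddObject

/-! ### Approximations by add M, and a finiteness argument in End(M) -/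

section FunctoriallyFinite

variable {Λ : Type u} [Ring Λ]

/-- The approximation is a sum of copies of M indexed by a k-basis of Hom(M, X); expanding a
morphism M ⟶ X in the basis factors it. -/
theorem isContravariantlyFinite_addObject (k : Type u) [Field k] [Algebra k Λ]
    [FiniteDimensional k Λ] (M : ModuleCat.{u} Λᵐᵒᵖ) [Module.Finite Λᵐᵒᵖ M] :
    IsContravariantlyFinite (addObject M) := by
  intro X _
  have : FiniteDimensional k (M ⟶ X) := finiteDimensional_hom M X
  let β := Module.finBasis k (M ⟶ X)
  let Y : ModuleCat.{u} Λᵐᵒᵖ := ModuleCat.of Λᵐᵒᵖ (Fin (Module.finrank k (M ⟶ X)) → M)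
  let π (i) : Y ⟶ M := ModuleCat.ofHom (LinearMap.proj i)
  refine ⟨Y, ∑ i, π i ≫ β i, ⟨_, fun _ => M, fun _ => ⟨Iso.refl M⟩, ⟨Retract.refl _⟩⟩,
    fun Y' g hY' => ?_⟩
  obtain ⟨m, a, b, hab⟩ := addObject_iff.1 hY'
  let l (j : Fin m) : M ⟶ Y :=
    ModuleCat.ofHom (LinearMap.pi fun i => (β.repr (b j ≫ g) i • 𝟙 M : M ⟶ M).hom)
  have hl : ∀ j i, l j ≫ π i = β.repr (b j ≫ g) i • 𝟙 M := fun j i => rfl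
  refine ⟨∑ j, a j ≫ l j, ?_⟩
  have key : ∀ j, l j ≫ ∑ i, π i ≫ β i = b j ≫ g := by
    intro j
    rw [Preadditive.comp_sum]
    simp_rw [← Category.assoc, hl, Linear.smul_comp, Category.id_comp]
    exact β.sum_repr _
  rw [Preadditive.sum_comp]
  simp_rw [Category.assoc, key, ← Category.assoc]
  rw [← Preadditive.sum_comp, hab, Category.id_comp]

theorem isCovariantlyFinite_addObject (k : Type u) [Field k] [Algebra k Λ]
    [FiniteDimensional k Λ] (M : ModuleCat.{u} Λᵐᵒᵖ) [Module.Finite Λᵐᵒᵖ M] :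
    IsCovariantlyFinite (addObject M) := by
  intro X _
  have : FiniteDimensional k (X ⟶ M) := finiteDimensional_hom X M
  let β := Module.finBasis k (X ⟶ M)
  let Y : ModuleCat.{u} Λᵐᵒᵖ := ModuleCat.of Λᵐᵒᵖ (Fin (Module.finrank k (X ⟶ M)) → M)
  let π (i) : Y ⟶ M := ModuleCat.ofHom (LinearMap.proj i)
  let f : X ⟶ Y := ModuleCat.ofHom (LinearMap.pi fun i => (β i).hom)
  have hf : ∀ i, f ≫ π i = β i := fun i => rfl
  refine ⟨Y, f, ⟨_, fun _ => M, fun _ => ⟨Iso.refl M⟩, ⟨Retract.refl _⟩⟩, fun Y' g hY' => ?_⟩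
  obtain ⟨m, a, b, hab⟩ := addObject_iff.1 hY'
  refine ⟨∑ j, (∑ i, β.repr (g ≫ a j) i • π i) ≫ b j, ?_⟩
  have key : ∀ j, f ≫ ∑ i, β.repr (g ≫ a j) i • π i = g ≫ a j := by
    intro j
    rw [Preadditive.comp_sum]
    simp_rw [Linear.comp_smul, hf]
    exact β.sum_repr _
  rw [Preadditive.comp_sum]
  simp_rw [← Category.assoc, key, Category.assoc]
  rw [← Preadditive.comp_sum, hab, Category.comp_id]

/-- A sequence in `add M` without nonzero morphisms from later to earlier terms contains a
zero object. -/
theorem exists_id_eq_zero_of_hom_eq_zero (k : Type u) [Field k] [Algebra k Λ]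
    [FiniteDimensional k Λ] {M : ModuleCat.{u} Λᵐᵒᵖ} [Module.Finite Λᵐᵒᵖ M]
    {Y : ℕ → ModuleCat.{u} Λᵐᵒᵖ} (hY : ∀ n, addObject M (Y n))
    (h : ∀ j i, j < i → ∀ f : Y i ⟶ Y j, f = 0) : ∃ n, 𝟙 (Y n) = 0 := by
  have : FiniteDimensional k (M ⟶ M) := finiteDimensional_hom M M
  -- J n is spanned by the endomorphisms of M factoring through some Y i with i ≥ n. This decreasing
  -- chain in a finite-dimensional space stabilizes.
  let J (n : ℕ) : Submodule k (M ⟶ M) :=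
    Submodule.span k {φ | ∃ i, n ≤ i ∧ ∃ (f : M ⟶ Y i) (g : Y i ⟶ M), f ≫ g = φ}
  have hJ : ∀ m n, m ≤ n → J n ≤ J m := fun m n hmn =>
    Submodule.span_mono fun φ ⟨i, hi, hφ⟩ => ⟨i, hmn.trans hi, hφ⟩
  obtain ⟨n, hn⟩ := IsArtinian.monotone_stabilizes
    (⟨fun n => OrderDual.toDual (J n), fun m n hmn => hJ m n hmn⟩ : ℕ →o (Submodule k (M ⟶ M))ᵒᵈ)
  have hn' : J n = J (n + 1) := hn (n + 1) (Nat.le_succ n)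
  refine ⟨n, ?_⟩
  obtain ⟨m, a, b, hab⟩ := addObject_iff.1 (hY n)
  have key : ∀ φ ∈ J (n + 1), ∀ (f : Y n ⟶ M) (g : M ⟶ Y n), f ≫ φ ≫ g = 0 := by
    intro φ hφ f g
    induction hφ using Submodule.span_induction with
    | mem φ hφ =>
      obtain ⟨i, hi, u, v, rfl⟩ := hφ
      rw [Category.assoc, h n i hi (v ≫ g), Limits.comp_zero, Limits.comp_zero]
    | zero => rw [Limits.zero_comp, Limits.comp_zero]
    | add φ ψ _ _ hφ hψ => rw [Preadditive.add_comp, Preadditive.comp_add, hφ, hψ, add_zero]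
    | smul c φ _ hφ => rw [Linear.smul_comp, Linear.comp_smul, hφ, smul_zero]
  -- Expanding the identity twice puts b j ≫ a l in the middle of each term. It lies in J n = J (n +
  -- 1), so it is a combination of maps through later objects, which have no nonzero morphism back
  -- to Y n.
  rw [← Category.comp_id (𝟙 (Y n)), ← hab, Preadditive.sum_comp]
  refine Finset.sum_eq_zero fun j _ => ?_
  rw [Preadditive.comp_sum]
  refine Finset.sum_eq_zero fun l _ => ?_
  have := key (b j ≫ a l) (hn' ▸ Submodule.subset_span ⟨n, le_rfl, _, _, rfl⟩) (a j) (b l)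
  simpa using this

end FunctoriallyFinite

/-! ### From a cluster tilting object to Λ in the closure -/

section Closure

variable {k : Type u} [Field k] {Λ : Type u} [Ring Λ] [Algebra k Λ]

theorem tauClosure_of_isIteratedTranslate {i : ℕ} {X : ModuleCat.{u} Λᵐᵒᵖ}
    (h : IsIteratedTranslate k 2 i (dualAlgebra k Λ) X) : tauClosure k Λ 2 X :=
  addClosure_of_mem ⟨i, h⟩

theorem tauClosure_dualAlgebra : tauClosure k Λ 2 (dualAlgebra k Λ) :=
  tauClosure_of_isIteratedTranslate (i := 0) ⟨Iso.refl _⟩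

variable [FiniteDimensional k Λ]

/-- Functoriality carries a decomposition of the identity of U through translates τ₂^i DΛ to one of
τ₂U through τ₂^(i+1) DΛ; the resolution of U need not be minimal. -/
theorem tauClosure_tau (hgl : GlobalDimensionLE Λᵐᵒᵖ 2) {U : ModuleCat.{u} Λᵐᵒᵖ}
    (hU : tauClosure k Λ 2 U) (R : Presentation U) (hR : Function.Injective R.d₂) :
    tauClosure k Λ 2 (R.tau k) := by
  obtain ⟨m, Z, a, b, hZ, hab⟩ := addClosure_iff.1 hU
  choose i hi using hZ
  have := fun j => finite_of_isIteratedTranslate (hi j)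
  choose X hX using fun j => exists_isHigherARTranslate k (Z j)
  choose R' hR' e using fun j => exists_resolution_of_isHigherARTranslate hgl (hX j)
  obtain ⟨a', b', hab'⟩ := exists_tau_decomposition (k := k) R hR R' a b hab
  exact addClosure_of_sum a' b' (fun j => addClosure_of_iso (e j).some.symm
    (tauClosure_of_isIteratedTranslate (i := i j + 1) ⟨Z j, hi j, hX j⟩)) hab'

/-- `Y` is an inverse translate of `X`: the module `X` is the direct sum of an injective module and
the translate of `Y`, and `Hom(Y, Λ) = 0`. -/
def IsInverseTranslate (k : Type u) [Field k] [Algebra k Λ] (X Y : ModuleCat.{u} Λᵐᵒᵖ) : Prop :=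
  ∃ (R : Presentation Y) (H : ModuleCat.{u} Λᵐᵒᵖ) (a : X ⟶ nakayama k Λ H)
    (b : nakayama k Λ H ⟶ X) (c : X ⟶ R.tau k) (d : R.tau k ⟶ X),
    Function.Injective R.d₂ ∧ Module.Finite Λᵐᵒᵖ H ∧ Module.Projective Λᵐᵒᵖ H ∧
    a ≫ b + c ≫ d = 𝟙 X ∧ d ≫ c = 𝟙 _ ∧ ∀ f : Y ⟶ regular Λ, f = 0

theorem IsInverseTranslate.tauClosure (hgl : GlobalDimensionLE Λᵐᵒᵖ 2)
    {X Y : ModuleCat.{u} Λᵐᵒᵖ} (h : IsInverseTranslate k X Y) (hY : tauClosure k Λ 2 Y) :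
    tauClosure k Λ 2 X := by
  obtain ⟨R, H, a, b, c, d, hR, _, _, habcd, -, -⟩ := h
  exact addClosure_of_add a b c d habcd (addClosure_nakayama tauClosure_dualAlgebra H)
    (tauClosure_tau hgl hY R hR)

/-- The translates of Y and Y' are summands of X and X', so they too have no nonzero morphisms
between them. -/
theorem IsInverseTranslate.hom_eq_zero {X Y X' Y' : ModuleCat.{u} Λᵐᵒᵖ}
    (h : IsInverseTranslate k X Y) (h' : IsInverseTranslate k X' Y')
    (hY : Subsingleton (Abelian.Ext Y (regular Λ) 1)) (hX : ∀ f : X ⟶ X', f = 0) (f : Y ⟶ Y') :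
    f = 0 := by
  obtain ⟨R, H, a, b, c, d, hR, _, _, -, hdc, h0⟩ := h
  obtain ⟨R', H', a', b', c', d', hR', _, _, -, hdc', -⟩ := h'
  refine hom_eq_zero_of_hom_tau_eq_zero (k := k) R R' hY h0 (fun t => ?_) f
  have : d ≫ (c ≫ t ≫ d') ≫ c' = t := by
    rw [Category.assoc, Category.assoc, hdc', Category.comp_id, ← Category.assoc, hdc,
      Category.id_comp]
  rw [← this, hX (c ≫ t ≫ d'), Limits.zero_comp, Limits.comp_zero]

theorem exists_isInverseTranslate (hgl : GlobalDimensionLE Λᵐᵒᵖ 2) (X : ModuleCat.{u} Λᵐᵒᵖ)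
    [Module.Finite Λᵐᵒᵖ X] (hX : Subsingleton (Abelian.Ext (dualAlgebra k Λ) X 1)) :
    ∃ Y : ModuleCat.{u} Λᵐᵒᵖ, IsInverseTranslate k X Y ∧ Module.Finite Λᵐᵒᵖ Y ∧
      ∀ W, Subsingleton (Abelian.Ext W X 1) → Subsingleton (Abelian.Ext Y W 1) := by
  obtain ⟨Y, R, H, a, b, c, d, hY, hR, hH, hH', h1, h2, h3, h4⟩ := exists_inverse_translate hgl X hX
  exact ⟨Y, ⟨R, H, a, b, c, d, hR, hH, hH', h1, h2, h4⟩, hY, h3⟩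

theorem subsingleton_ext_of_lt_two {R : Type u} [Ring R] {X Y : ModuleCat.{u} R}
    (h : Subsingleton (Abelian.Ext X Y 1)) (i : ℕ) (h0 : 0 < i) (h2 : i < 2) :
    Subsingleton (Abelian.Ext X Y i) := by
  obtain rfl : i = 1 := by omega
  exact h

theorem tauClosure_regular_of_isClusterTiltingObject (hgl : GlobalDimensionLE Λᵐᵒᵖ 2)
    {M : ModuleCat.{u} Λᵐᵒᵖ} (hM : IsClusterTiltingObject 2 M) :
    tauClosure k Λ 2 (regular Λ) := by
  obtain ⟨_, hC⟩ := hM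
  have hext : ∀ {X Y}, addObject M X → addObject M Y → Subsingleton (Abelian.Ext X Y 1) :=
    fun hX hY => ((hC.mem_iff_left _).1 hX).2 _ hY 1 one_pos one_lt_two
  have hD : addObject M (dualAlgebra k Λ) := (hC.mem_iff_right _).2
    ⟨finite_dualAlgebra, fun Y _ => subsingleton_ext_of_lt_two (ext_one_dualAlgebra Y)⟩
  have hΛ : addObject M (regular Λ) := (hC.mem_iff_left _).2
    ⟨inferInstanceAs (Module.Finite Λᵐᵒᵖ Λ), fun Y _ => subsingleton_ext_of_lt_two
      (subsingleton_of_forall_eq 0 Abelian.Ext.eq_zero_of_projective)⟩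
  have hstep : ∀ X : {X // addObject M X}, ∃ Y : {Y // addObject M Y},
      IsInverseTranslate k X.1 Y.1 := by
    rintro ⟨X, hX⟩
    have := ((hC.mem_iff_left _).1 hX).1
    obtain ⟨Y, hXY, hYf, hY⟩ := exists_isInverseTranslate hgl X (hext hD hX)
    exact ⟨⟨Y, (hC.mem_iff_left _).2
      ⟨hYf, fun W hW => subsingleton_ext_of_lt_two (hY W (hext hW hX))⟩⟩, hXY⟩
  choose F hF using hstep
  -- Iterated inverse translates of Λ inside add M; each later term has no nonzero morphism to Λ,
  -- and `hom_eq_zero` propagates this to every earlier term.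
  let Y (n : ℕ) : {Y // addObject M Y} := F^[n] ⟨regular Λ, hΛ⟩
  have hY : ∀ n, IsInverseTranslate k (Y n).1 (Y (n + 1)).1 := by
    intro n
    simp only [Y, Function.iterate_succ_apply']
    exact hF _
  have hzero : ∀ j i, j < i → ∀ f : (Y i).1 ⟶ (Y j).1, f = 0 := by
    intro j
    induction j with
    | zero =>
      rintro (_ | i) hi f
      · omega
      · obtain ⟨-, -, -, -, -, -, -, -, -, -, -, h⟩ := hY i
        exact h f
    | succ j ih =>
      rintro (_ | i) hi f
      · omega
      · exact (hY i).hom_eq_zero (hY j) (hext (Y (i + 1)).2 hΛ) (ih i (by omega)) f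
  obtain ⟨n, hn⟩ := exists_id_eq_zero_of_hom_eq_zero k (fun n => (Y n).2) hzero
  have hdown : ∀ n, tauClosure k Λ 2 (Y n).1 → tauClosure k Λ 2 (regular Λ) := by
    intro n
    induction n with
    | zero => exact id
    | succ n ih => exact fun h => ih ((hY n).tauClosure hgl h)
  exact hdown n (addClosure_of_id_eq_zero hn)

end Closure

/-! ### From Λ in the closure to a cluster tilting object -/

section Converse

variable {k : Type u} [Field k] {Λ : Type u} [Ring Λ] [Algebra k Λ]

variable (k) in
/-- There are no nonzero morphisms from the first `n` translates of `DΛ` to `V`. -/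
def HomVanishes (n : ℕ) (V : ModuleCat.{u} Λᵐᵒᵖ) : Prop :=
  ∀ i < n, ∀ Z, IsIteratedTranslate k 2 i (dualAlgebra k Λ) Z → ∀ f : Z ⟶ V, f = 0

theorem HomVanishes.of_iso {n : ℕ} {V V' : ModuleCat.{u} Λᵐᵒᵖ} (h : HomVanishes k n V)
    (e : V' ≅ V) : HomVanishes k n V' := fun i hi Z hZ f =>
  (cancel_mono e.hom).1 ((h i hi Z hZ (f ≫ e.hom)).trans Limits.zero_comp.symm)

theorem nonempty_iso_of_isIteratedTranslate (hgl : GlobalDimensionLE Λᵐᵒᵖ 2) :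
    ∀ (i : ℕ) {X Y Z : ModuleCat.{u} Λᵐᵒᵖ}, IsIteratedTranslate k 2 i X Y →
      IsIteratedTranslate k 2 i X Z → Nonempty (Y ≅ Z)
  | 0, _, _, _, ⟨e⟩, ⟨e'⟩ => ⟨e.symm ≪≫ e'⟩
  | i + 1, _, _, _, ⟨_, hW, hY⟩, ⟨_, hW', hZ⟩ => by
    obtain ⟨e⟩ := nonempty_iso_of_isIteratedTranslate hgl i hW hW'
    obtain ⟨R, hR, ⟨f⟩⟩ := exists_resolution_of_isHigherARTranslate hgl hY
    obtain ⟨R', hR', ⟨f'⟩⟩ := exists_resolution_of_isHigherARTranslate hgl hZ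
    obtain ⟨t⟩ := nonempty_tau_iso (k := k) e R R' hR hR'
    exact ⟨f ≪≫ t ≪≫ f'.symm⟩

theorem exists_forall_homVanishes (hΛ : tauClosure k Λ 2 (regular Λ)) :
    ∃ n, ∀ V : ModuleCat.{u} Λᵐᵒᵖ, HomVanishes k n V → 𝟙 V = 0 := by
  obtain ⟨m, Z, a, b, hZ, hab⟩ := addClosure_iff.1 hΛ
  choose i hi using hZ
  -- One more than the largest exponent of a translate used to build Λ, since `HomVanishes` bounds
  -- exponents strictly.
  refine ⟨Finset.univ.sup i + 1, fun V hV => ?_⟩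
  have h0 : ∀ f : regular Λ ⟶ V, f = 0 := by
    intro f
    rw [← Category.id_comp f, ← hab, Preadditive.sum_comp]
    refine Finset.sum_eq_zero fun j _ => ?_
    rw [Category.assoc, hV (i j) (Nat.lt_succ_of_le (Finset.le_sup (Finset.mem_univ j))) _ (hi j)
      (b j ≫ f), Limits.comp_zero]
  ext v
  exact (fromRegular_apply_one v).symm.trans
    (congrArg (fun f : regular Λ ⟶ V => f (1 : Λ)) (h0 (fromRegular v)))

variable [FiniteDimensional k Λ]

theorem ext_one_of_tauClosure {X Y : ModuleCat.{u} Λᵐᵒᵖ} (hX : tauClosure k Λ 2 X)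
    (hY : tauClosure k Λ 2 Y) : Subsingleton (Abelian.Ext X Y 1) :=
  isRigid_tauClosure.ext_eq_zero X Y hX hY 1 one_pos one_lt_two

/-- The range grows by one: DΛ never maps nontrivially to a translate, and a morphism τ₂W ⟶ τ₂V is
induced by some W ⟶ V, because Ext¹(W, Λ) = 0 by rigidity. -/
theorem HomVanishes.tau (hgl : GlobalDimensionLE Λᵐᵒᵖ 2) (hΛ : tauClosure k Λ 2 (regular Λ))
    {n : ℕ} {V : ModuleCat.{u} Λᵐᵒᵖ} (hV : HomVanishes k n V) (R : Presentation V)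
    (hR : Function.Injective R.d₂) : HomVanishes k (n + 1) (R.tau k) := by
  rintro (_ | i) hi Z hZ f
  · obtain ⟨e⟩ := hZ
    exact (cancel_epi e.hom).1 ((hom_dualAlgebra_tau_eq_zero R hR _).trans
      Limits.comp_zero.symm)
  · obtain ⟨W, hW, hWZ⟩ := hZ
    obtain ⟨R', hR', ⟨e⟩⟩ := exists_resolution_of_isHigherARTranslate hgl hWZ
    exact (cancel_epi e.inv).1 ((hom_tau_eq_zero R' R hR
      (ext_one_of_tauClosure (tauClosure_of_isIteratedTranslate hW) hΛ)
      (hV i (by omega) W hW) _).trans Limits.comp_zero.symm)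

theorem homVanishes_of_isIteratedTranslate (hgl : GlobalDimensionLE Λᵐᵒᵖ 2)
    (hΛ : tauClosure k Λ 2 (regular Λ)) : ∀ (m : ℕ) {V : ModuleCat.{u} Λᵐᵒᵖ},
      IsIteratedTranslate k 2 m (dualAlgebra k Λ) V → HomVanishes k m V
  | 0, _, _ => fun i hi => absurd hi (Nat.not_lt_zero i)
  | m + 1, _, ⟨_, hW, hWV⟩ => by
    obtain ⟨R, hR, ⟨e⟩⟩ := exists_resolution_of_isHigherARTranslate hgl hWV
    exact ((homVanishes_of_isIteratedTranslate hgl hΛ m hW).tau hgl hΛ R hR).of_iso e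

theorem exists_isIteratedTranslate (k Λ : Type u) [Field k] [Ring Λ] [Algebra k Λ]
    [FiniteDimensional k Λ] :
    ∀ i : ℕ, ∃ X : ModuleCat.{u} Λᵐᵒᵖ, IsIteratedTranslate k 2 i (dualAlgebra k Λ) X
  | 0 => ⟨_, ⟨Iso.refl _⟩⟩
  | i + 1 => by
    obtain ⟨Z, hZ⟩ := exists_isIteratedTranslate k Λ i
    have := finite_of_isIteratedTranslate hZ
    obtain ⟨X, hX⟩ := exists_isHigherARTranslate k Z
    exact ⟨X, Z, hZ, hX⟩

/-- If `Λ` lies in the closure, the closure is additively generated by one object. -/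
theorem exists_addObject_eq_tauClosure (hgl : GlobalDimensionLE Λᵐᵒᵖ 2)
    (hΛ : tauClosure k Λ 2 (regular Λ)) :
    ∃ M : ModuleCat.{u} Λᵐᵒᵖ, Module.Finite Λᵐᵒᵖ M ∧ addObject M = tauClosure k Λ 2 := by
  obtain ⟨n, hn⟩ := exists_forall_homVanishes hΛ
  choose X hX using exists_isIteratedTranslate k Λ
  let M : ModuleCat.{u} Λᵐᵒᵖ := ModuleCat.of Λᵐᵒᵖ (∀ i : Fin n, X i)
  have hM : tauClosure k Λ 2 M :=
    ⟨n, fun i => X i, fun i => ⟨i, hX i⟩, ⟨Retract.refl _⟩⟩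
  refine ⟨M, isRigid_tauClosure.finite M hM, funext fun Z => propext ⟨fun hZ => ?_, fun hZ => ?_⟩⟩
  · exact addClosure_of_le (fun _ ⟨e⟩ => addClosure_of_iso e hM) hZ
  · refine addClosure_of_le ?_ hZ
    rintro W ⟨i, hi⟩
    by_cases hin : i < n
    · obtain ⟨e⟩ := nonempty_iso_of_isIteratedTranslate hgl i hi (hX i)
      refine addClosure_of_iso e (addClosure_of_retract (U := M)
        (ModuleCat.ofHom (LinearMap.single Λᵐᵒᵖ (fun i : Fin n => X i) ⟨i, hin⟩))
        (ModuleCat.ofHom (LinearMap.proj (φ := fun i : Fin n => X i) ⟨i, hin⟩)) ?_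
        (addClosure_of_mem ⟨Iso.refl M⟩))
      ext x
      exact Pi.single_eq_same (M := fun i : Fin n => X i) ⟨i, hin⟩ x
    -- Translates with exponent at least n receive nothing from the first n translates, hence are
    -- zero.
    · exact addClosure_of_id_eq_zero (hn W fun j hj =>
        homVanishes_of_isIteratedTranslate hgl hΛ i hi j (by omega))

/-- For W in the closure, τ₂W is in it too, so Ext¹(X, τ₂W) = 0; as Ext¹(W, Λ) = 0, the duality
converts this into Ext¹(W, X) = 0. -/
theorem ext_one_of_forall_ext_one (hgl : GlobalDimensionLE Λᵐᵒᵖ 2)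
    (hΛ : tauClosure k Λ 2 (regular Λ)) {X : ModuleCat.{u} Λᵐᵒᵖ}
    (hX : ∀ W, tauClosure k Λ 2 W → Subsingleton (Abelian.Ext X W 1)) (W : ModuleCat.{u} Λᵐᵒᵖ)
    (hW : tauClosure k Λ 2 W) : Subsingleton (Abelian.Ext W X 1) := by
  have := isRigid_tauClosure.finite W hW
  obtain ⟨R, hR⟩ := exists_resolution k hgl W
  exact R.ext_one_of_ext_one_tau (ext_one_of_tauClosure hW hΛ)
    (hX _ (tauClosure_tau hgl hW R hR))

/-- By induction, X = νH ⊕ τ₂Y and Y inherits the hypothesis. Splitting Y and translating back gives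
X = (νH ⊕ τ₂U) ⊕ τ₂V, where τ₂V receives no nonzero morphism from one translate more than V. -/
theorem exists_decomposition (hgl : GlobalDimensionLE Λᵐᵒᵖ 2)
    (hΛ : tauClosure k Λ 2 (regular Λ)) (n : ℕ) : ∀ X : ModuleCat.{u} Λᵐᵒᵖ,
      Module.Finite Λᵐᵒᵖ X → (∀ W, tauClosure k Λ 2 W → Subsingleton (Abelian.Ext W X 1)) →
      ∃ (U V : ModuleCat.{u} Λᵐᵒᵖ) (a : X ⟶ U) (b : U ⟶ X) (c : X ⟶ V) (d : V ⟶ X),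
        tauClosure k Λ 2 U ∧ Module.Finite Λᵐᵒᵖ V ∧ HomVanishes k n V ∧
        a ≫ b + c ≫ d = 𝟙 X := by
  induction n with
  | zero =>
    intro X hXf _
    exact ⟨dualAlgebra k Λ, X, 0, 0, 𝟙 X, 𝟙 X, tauClosure_dualAlgebra, hXf,
      fun i hi => absurd hi (Nat.not_lt_zero i), by simp⟩
  | succ n ih =>
    intro X _ hX
    obtain ⟨Y, ⟨R, H, a, b, c, d, hR, _, _, habcd, -, -⟩, hYf, hY⟩ :=
      exists_isInverseTranslate hgl X (hX _ tauClosure_dualAlgebra)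
    obtain ⟨U, V, a', b', c', d', hU, _, hV, h'⟩ := ih Y hYf
      (ext_one_of_forall_ext_one hgl hΛ fun W hW => hY W (hX W hW))
    have := isRigid_tauClosure.finite U hU
    obtain ⟨RU, hRU⟩ := exists_resolution k hgl U
    obtain ⟨RV, hRV⟩ := exists_resolution k hgl V
    obtain ⟨ta, hta⟩ := exists_isTauMap (k := k) R RU a'
    obtain ⟨tb, htb⟩ := exists_isTauMap (k := k) RU R b'
    obtain ⟨tc, htc⟩ := exists_isTauMap (k := k) R RV c'
    obtain ⟨td, htd⟩ := exists_isTauMap (k := k) RV R d'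
    have ht : ta ≫ tb + tc ≫ td = 𝟙 _ := by
      have := (hta.comp htb).add (htc.comp htd)
      rw [h'] at this
      exact this.unique (IsTauMap.id R) hR
    refine ⟨nakayama k Λ H ⊞ RU.tau k, RV.tau k, Limits.biprod.lift a (c ≫ ta),
      Limits.biprod.desc b (tb ≫ d), c ≫ tc, td ≫ d, ?_, RV.finite_tau, hV.tau hgl hΛ RV hRV, ?_⟩
    · exact addClosure_of_add _ _ _ _ Limits.biprod.total
        (addClosure_nakayama tauClosure_dualAlgebra H) (tauClosure_tau hgl hU RU hRU)
    · rw [Limits.biprod.lift_desc, ← habcd, add_assoc]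
      congr 1
      conv_rhs => rw [← Category.id_comp d, ← ht]
      simp [Preadditive.add_comp, Preadditive.comp_add]

/-- For n large enough the summand V of the decomposition is zero, leaving X as a summand of U. -/
theorem tauClosure_of_ext_one (hgl : GlobalDimensionLE Λᵐᵒᵖ 2)
    (hΛ : tauClosure k Λ 2 (regular Λ)) (X : ModuleCat.{u} Λᵐᵒᵖ) (hXf : Module.Finite Λᵐᵒᵖ X)
    (hX : ∀ W, tauClosure k Λ 2 W → Subsingleton (Abelian.Ext W X 1)) : tauClosure k Λ 2 X := by
  obtain ⟨n, hn⟩ := exists_forall_homVanishes hΛ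
  obtain ⟨U, V, a, b, c, d, hU, -, hV, h⟩ := exists_decomposition hgl hΛ n X hXf hX
  refine addClosure_of_retract a b ?_ hU
  rw [← h, ← Category.id_comp d, hn V hV, Limits.zero_comp, Limits.comp_zero, add_zero]

theorem exists_isClusterTiltingObject (hgl : GlobalDimensionLE Λᵐᵒᵖ 2)
    (hΛ : tauClosure k Λ 2 (regular Λ)) :
    ∃ M : ModuleCat.{u} Λᵐᵒᵖ, IsClusterTiltingObject 2 M := by
  obtain ⟨M, hMf, hM⟩ := exists_addObject_eq_tauClosure hgl hΛ
  refine ⟨M, hMf, isContravariantlyFinite_addObject k M, isCovariantlyFinite_addObject k M, ?_, ?_⟩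
  · rw [hM]
    exact fun X => ⟨fun hX => ⟨isRigid_tauClosure.finite X hX, fun Y hY =>
      isRigid_tauClosure.ext_eq_zero X Y hX hY⟩, fun ⟨hXf, hX⟩ => tauClosure_of_ext_one hgl hΛ X hXf
        (ext_one_of_forall_ext_one hgl hΛ fun W hW => hX W hW 1 one_pos one_lt_two)⟩
  · rw [hM]
    exact fun X => ⟨fun hX => ⟨isRigid_tauClosure.finite X hX, fun Y hY =>
      isRigid_tauClosure.ext_eq_zero Y X hY hX⟩, fun ⟨hXf, hX⟩ => tauClosure_of_ext_one hgl hΛ X hXf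
        fun W hW => hX W hW 1 one_pos one_lt_two⟩

end Converse

end HigherAR

theorem mainTheorem12 (k : Type u) [Field k] (Λ : Type u) [Ring Λ] [Algebra k Λ]
    [FiniteDimensional k Λ] :
    HigherAR.IsRigid 2 (HigherAR.tauClosure k Λ 2) ∧
      (HigherAR.GlobalDimensionLE Λᵐᵒᵖ 2 →
        ((∃ M : ModuleCat.{u} Λᵐᵒᵖ, HigherAR.IsClusterTiltingObject 2 M) ↔
          HigherAR.tauClosure k Λ 2 (ModuleCat.of Λᵐᵒᵖ Λ))) :=
  ⟨HigherAR.isRigid_tauClosure, fun hgl =>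
    ⟨fun ⟨_, hM⟩ => HigherAR.tauClosure_regular_of_isClusterTiltingObject hgl hM,
      HigherAR.exists_isClusterTiltingObject hgl⟩⟩
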